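/- For $0<\alpha<1$, $s\ge 0$, $t>0$ let $$g_\alpha(s;t)=\frac1{t^{\alpha}}W_{-\alpha,1-\alpha}\!\left(-\frac{s}{t^{\alpha}}\right),\qquad W_{\lambda,\delta}(z)=\sum_{k=0}^\infty \frac{z^k}{k!\,\Gamma(\lambda k+\delta)}$$ (with $1/\Gamma=0$ at the poles of $\Gamma$). For $0<\beta<1$ let ${}_CD_t^\beta f(t)=\frac{1}{\Gamma(1-\beta)}\int_0^t (t-\tau)^{-\beta}f'(\tau)\,d\tau$ be the Caputo derivative, and ${}_CD_t^1f=f'$. Let $0<\alpha<1$, $0<\beta\le 1$, let $I\subseteq\mathbb R$ be open and let $\sigma,\mu:\mathbb R\to\mathbb R$ be functions. By a solution of order $\beta$ we mean a function $u(x,t)$, $x\in I$, $t\ge 0$, such that * for each $x\in I$, $u(x,\cdot)$ is continuous on $[0,\infty)$, differentiable on $(0,\infty)$, $u_t(x,\cdot)$ is integrable on $(0,t)$ for each $t>0$, and, if $\beta<1$, so is $\tau\mapsto(t-\tau)^{-\beta}u_t(x,\tau)$; * for each $t>0$, $u(\cdot,t)$ is twice differentiable on $I$; * for all $x\in I$,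 $t>0$, $${}_CD_t^{\beta}u(x,t)=\sigma(x)\frac{\partial^2u}{\partial x^2}(x,t)+\mu(x)\frac{\partial u}{\partial x}(x,t).$$ Let $u_\beta$ be a solution of order $\beta$ whose Laplace integrals converge absolutely, in the following sense: for each $x\in I$ there is $a\in\mathbb R$ with $\int_0^\infty e^{-as}|\partial_s u_\beta(x,s)|\,ds<\infty$; and each $x\in I$ has a neighbourhood $N$ for which there are $a\in\mathbb R$ and a function $h$ on $(0,\infty)$ such that $e^{-as}h(s)$ is integrable on $(0,\infty)$ and $|\partial_x u_\beta(y,s)|\le h(s)$, $|\partial_x^2 u_\beta(y,s)|\le h(s)$ for all $y\in N\cap I$, $s>0$. Then for all $x\in I$, $t>0$ the integral $$u_{\beta\alpha}(x,t)=\int_0^\infty u_\beta(x,s)\,g_\alpha(s;t)\,ds$$ converges absolutely, and $u_{\beta\alpha}$, extended by $u_{\beta\alpha}(x,0)=u_\beta(x,0)$, is a solution of order $\beta\alpha$, with the same $I$, $\sigma$ and $\mu$; in particular, for all $x\in I$, $t>0$, $${}_CD_t^{\beta\alpha}u_{\beta\alpha}(x,t)=\sigma(x)\frac{\partial^2u_{\beta\alpha}}{\partial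 x^2}(x,t)+\mu(x)\frac{\partial u_{\beta\alpha}}{\partial x}(x,t).$$ -/

import Mathlib

open MeasureTheory Set Filter Topology

noncomputable section

/-- The Wright function `W_{l,d}(z) = ∑ₖ zᵏ / (k! Γ(l k + d))` at a real point.  At the poles of `Γ`
the coefficient `1 / Γ` is `0`, which is also what `Real.Gamma` and division return there. -/
def wrightW (l d z : ℝ) : ℝ :=
  ∑' k : ℕ, z ^ k / ((k.factorial : ℝ) * Real.Gamma (l * k + d))

/-- The Wright-type function `g_α(s;t) = t^{-α} W_{-α,1-α}(-s / t^α)`, for `0 < α < 1` and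
`t > 0`: the density of the inverse `α`-stable subordinator at time `t`. -/
def wrightG (α s t : ℝ) : ℝ :=
  1 / t ^ α * wrightW (-α) (1 - α) (-s / t ^ α)

/-- The `α`-Wright type transformation `t ↦ ∫₀^∞ f(s) g_α(s;t) ds` of a function on `[0,∞)`.
At the initial time, where `g_α(· ;0)` is the unit mass at `0`, its value is `f 0`. -/
def wrightTransform (α : ℝ) (f : ℝ → ℝ) (t : ℝ) : ℝ :=
  if t = 0 then f 0 else ∫ s in Ioi (0 : ℝ), f s * wrightG α s t

/-- The fractional integral `J^γ f(t) = Γ(γ)⁻¹ ∫₀ᵗ (t - τ)^{γ-1} f(τ) dτ`, with `J⁰ f = f`. -/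
def fracIntegral (γ : ℝ) (f : ℝ → ℝ) (t : ℝ) : ℝ :=
  if γ = 0 then f t else 1 / Real.Gamma γ * ∫ τ in (0 : ℝ)..t, (t - τ) ^ (γ - 1) * f τ

/-- The Caputo derivative `D_C^β f = J^{1-β} f'` of order `0 < β ≤ 1`. -/
def caputoDeriv (β : ℝ) (f : ℝ → ℝ) (t : ℝ) : ℝ :=
  fracIntegral (1 - β) (deriv f) t

/-- `∂u/∂x (x,t)`. -/
def partialX (u : ℝ → ℝ → ℝ) (x t : ℝ) : ℝ :=
  deriv (fun y => u y t) x

/-- `∂²u/∂x² (x,t)`. -/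
def partialXX (u : ℝ → ℝ → ℝ) (x t : ℝ) : ℝ :=
  deriv (fun y => partialX u y t) x

/-- `u = u(x,t)` is a solution on `I × [0,∞)` of the variable-coefficient fractional diffusion
equation `D_C^β u = σ(x) u_xx + μ(x) u_x` (Caputo derivative in `t`), in the pointwise sense.  All
derivatives and integrals that occur in the equation are required to exist. -/
structure IsFracDiffusionSolution (β : ℝ) (I : Set ℝ) (σ μ : ℝ → ℝ) (u : ℝ → ℝ → ℝ) : Prop where
  /-- continuity in time, up to the initial time -/
  continuousOn_time : ∀ x ∈ I, ContinuousOn (u x) (Ici 0)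
  /-- differentiability in time -/
  differentiableAt_time : ∀ x ∈ I, ∀ t > 0, DifferentiableAt ℝ (u x) t
  /-- `u(x,·)` is absolutely continuous up to the initial time -/
  integrable_deriv : ∀ x ∈ I, ∀ t > 0, IntervalIntegrable (deriv (u x)) volume 0 t
  /-- the integral that defines the Caputo derivative converges (for `β = 1` there is none) -/
  integrable_caputo : β ≠ 1 → ∀ x ∈ I, ∀ t > 0,
    IntervalIntegrable (fun τ => (t - τ) ^ (-β) * deriv (u x) τ) volume 0 t
  /-- differentiability in space -/
  differentiableAt_space : ∀ x ∈ I, ∀ t > 0, DifferentiableAt ℝ (fun y => u y t) x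
  /-- second differentiability in space -/
  differentiableAt_space_two : ∀ x ∈ I, ∀ t > 0, DifferentiableAt ℝ (fun y => partialX u y t) x
  /-- the equation -/
  equation : ∀ x ∈ I, ∀ t > 0,
    caputoDeriv β (u x) t = σ x * partialXX u x t + μ x * partialX u x t

/-- The Laplace integrals in `t` of `u_t`, `u_x`, `u_xx` converge absolutely in some half-line; for
the space derivatives this holds locally uniformly in `x`, in the sense of domination. -/
structure IsLaplaceDominated (I : Set ℝ) (u : ℝ → ℝ → ℝ) : Prop where
  /-- the Laplace integral of `u_t` -/
  time : ∀ x ∈ I, ∃ a : ℝ, IntegrableOn (fun s => Real.exp (-a * s) * deriv (u x) s) (Ioi 0)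
  /-- the Laplace integrals of `u_x` and `u_xx` -/
  space : ∀ x ∈ I, ∃ N ∈ 𝓝 x, ∃ a : ℝ, ∃ h : ℝ → ℝ,
    IntegrableOn (fun s => Real.exp (-a * s) * h s) (Ioi 0) ∧
      ∀ y ∈ N, ∀ s > 0, |partialX u y s| ≤ h s ∧ |partialXX u y s| ≤ h s

end

/-! Put `F_δ(s,t) = t^(δ-1) W_{-α,δ}(-s/t^α)`, so that `g_α = F_{1-α}`. In the Laplace variable `z`
dual to `t`, `F_δ` corresponds to `z^(-δ) exp(-s z^α)`. Hence differentiating in `s` turns `F_δ`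
into `-F_{δ-α}`, differentiating `g_α` in `t` gives `F_{-α}`, the fractional integral of order `γ`
in `t` turns `F_0` into `F_γ`, and the Weyl integral of order `1 - β` in `s` turns `g_α` into
`F_{1-βα}`.

For `f = u(x,·)` this gives the theorem. The time derivative of `∫ f g_α ds` is `∫ f F_{-α} ds`,
which equals `∫ f' F_0 ds` by parts, without boundary term because `F_0(0,t) = 0`. Applying
`J^(1-βα)` in `t` produces `∫ f' F_{1-βα} ds`, and moving the Weyl integral from the kernel to `f'`
produces `∫ (J^(1-β) f') g_α ds`. This is `caputoDeriv_wrightTransform`: the Caputo derivative of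
order `βα` of the transform is the transform of the one of order `β`. The coefficients depend on `x`
only and the `x`-derivatives pass under the integral, so the equation for `u` at each time `s`,
integrated against `g_α`, is the equation for the transform.

The kernel identities are proved on a Hankel contour. The lower half of the contour is the conjugate
of the upper half, so one ray suffices: `π F_δ` is the imaginary part of the integral of `exp(tz - s
z^α) z^(-δ)` along it (`hankelIntegral_im_eq_wrightF`, from Hankel's formula for `1/Γ` and termwise
integration). The tip `R` of the ray is free. Moving it outwards shows that the kernels decay in `s`
faster than every exponential (`exists_abs_wrightW_le`), which accommodates every `f` with an
absolutely convergent Laplace integral and justifies the interchanges of limits. -/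

/-! ### Geometry of the Hankel rays. -/

/-- The ray from the point `R` of the real axis in the direction of angle `θ`. -/
noncomputable def ray (θ R r : ℝ) : ℂ := R + r * Complex.exp (θ * Complex.I)

/-- The angles for which `exp z` decays on the rays and `exp (-s z ^ α)` does not grow there. -/
structure IsHankelAngle (α θ : ℝ) : Prop where
  pos : 0 < α
  lt_one : α < 1
  gt : Real.pi / 2 < θ
  lt : θ < Real.pi
  mul_lt : α * θ < Real.pi / 2

theorem exists_isHankelAngle {α : ℝ} (h0 : 0 < α) (h1 : α < 1) : ∃ θ, IsHankelAngle α θ := by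
  have hp := Real.pi_pos
  have : Real.pi / 2 < min Real.pi (Real.pi / (2 * α)) := by
    refine lt_min (by linarith) ?_
    rw [div_lt_div_iff₀ (by norm_num) (by positivity)]
    nlinarith
  obtain ⟨θ, hθ1, hθ2⟩ := exists_between this
  refine ⟨θ, h0, h1, hθ1, hθ2.trans_le (min_le_left _ _), ?_⟩
  have := hθ2.trans_le (min_le_right _ _)
  rw [lt_div_iff₀ (by positivity)] at this
  linarith

namespace IsHankelAngle

variable {α θ : ℝ}

theorem sin_pos (h : IsHankelAngle α θ) : 0 < Real.sin θ :=
  Real.sin_pos_of_pos_of_lt_pi (by linarith [h.gt, Real.pi_pos]) h.lt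

theorem cos_neg (h : IsHankelAngle α θ) : Real.cos θ < 0 :=
  Real.cos_neg_of_pi_div_two_lt_of_lt h.gt (by linarith [h.lt, Real.pi_pos])

theorem cos_mul_pos (h : IsHankelAngle α θ) : 0 < Real.cos (α * θ) :=
  Real.cos_pos_of_mem_Ioo ⟨by
    have := mul_pos h.pos (show 0 < θ by linarith [h.gt, Real.pi_pos])
    linarith [Real.pi_pos], h.mul_lt⟩

end IsHankelAngle

theorem ray_re (θ R r : ℝ) : (ray θ R r).re = R + r * Real.cos θ := by
  simp [ray, Complex.exp_ofReal_mul_I_re]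

theorem ray_im (θ R r : ℝ) : (ray θ R r).im = r * Real.sin θ := by
  simp [ray, Complex.exp_ofReal_mul_I_im]

theorem norm_ray_sq (θ R r : ℝ) :
    ‖ray θ R r‖ ^ 2 = (R + r * Real.cos θ) ^ 2 + (r * Real.sin θ) ^ 2 := by
  rw [← Complex.normSq_eq_norm_sq, Complex.normSq_apply, ray_re, ray_im]; ring

theorem norm_ray_le {θ R r : ℝ} (hR : 0 ≤ R) (hr : 0 ≤ r) : ‖ray θ R r‖ ≤ R + r := by
  refine (norm_add_le _ _).trans ?_
  rw [norm_mul, Complex.norm_exp_ofReal_mul_I, Complex.norm_real, Complex.norm_real,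
    Real.norm_of_nonneg hR, Real.norm_of_nonneg hr, mul_one]

/-- Up to sign, `R sin θ` is the distance from the origin to the line that carries the ray. -/
theorem le_norm_ray_left (θ R r : ℝ) :
    R * Real.sin θ ≤ ‖ray θ R r‖ := by
  refine abs_le_of_sq_le_sq' ?_ (norm_nonneg _) |>.2
  rw [norm_ray_sq]
  have := Real.sin_sq_add_cos_sq θ
  have h2 : (R + r * Real.cos θ) ^ 2 + (r * Real.sin θ) ^ 2
     = (R * Real.sin θ) ^ 2 + (r + R * Real.cos θ) ^ 2 := by
    linear_combination (r ^ 2 - R ^ 2) * this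
  rw [h2]; nlinarith [sq_nonneg (r + R * Real.cos θ)]

theorem le_norm_ray_right (θ R r : ℝ) :
    r * Real.sin θ ≤ ‖ray θ R r‖ := by
  refine abs_le_of_sq_le_sq' ?_ (norm_nonneg _) |>.2
  rw [norm_ray_sq]
  nlinarith [sq_nonneg (R + r * Real.cos θ)]

theorem ray_mem_slitPlane {θ R r : ℝ} (hR : 0 < R) (hr : 0 ≤ r) (hs : 0 < Real.sin θ) :
    ray θ R r ∈ Complex.slitPlane := by
  rw [Complex.mem_slitPlane_iff, ray_re, ray_im]
  rcases hr.eq_or_lt with rfl | hr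
  · left; simpa using hR
  · right; positivity

theorem arg_ray_nonneg {θ R r : ℝ} (hr : 0 ≤ r) (hs : 0 ≤ Real.sin θ) :
    0 ≤ (ray θ R r).arg := by
  rw [Complex.arg_nonneg_iff, ray_im]; positivity

/-- A point of the ray is the sum of a positive real and a vector of angle `θ`, so its angle lies
between `0` and `θ`. The proof compares the two expressions of the real part and uses `r ≤ ‖z‖ + R`.
-/
theorem arg_ray_le {α θ R r : ℝ} (h : IsHankelAngle α θ) (hR : 0 < R) (hr : 0 ≤ r) :
    (ray θ R r).arg ≤ θ := by
  by_contra! hlt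
  have hcos := Real.strictAntiOn_cos ⟨by linarith [h.gt, Real.pi_pos], h.lt.le⟩
    ⟨arg_ray_nonneg hr h.sin_pos.le, Complex.arg_le_pi _⟩ hlt
  have hpos : 0 < ‖ray θ R r‖ := norm_pos_iff.2
    (Complex.slitPlane_ne_zero (ray_mem_slitPlane hR hr h.sin_pos))
  have h1 := Complex.norm_mul_cos_arg (ray θ R r)
  rw [ray_re] at h1
  have h2 : r ≤ ‖ray θ R r‖ + R := by
    have : (r : ℂ) * Complex.exp (θ * Complex.I) = ray θ R r - R := by simp [ray]
    have h3 := congrArg norm this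
    rw [norm_mul, Complex.norm_exp_ofReal_mul_I, Complex.norm_real,
      Real.norm_of_nonneg hr, mul_one] at h3
    have h4 := norm_sub_le (ray θ R r) (R : ℂ)
    rw [Complex.norm_real, Real.norm_of_nonneg hR.le] at h4
    linarith
  nlinarith [mul_lt_mul_of_pos_left hcos hpos, h.cos_neg, Real.neg_one_le_cos θ]

theorem le_re_ray_cpow {α θ R r : ℝ} (h : IsHankelAngle α θ) (hR : 0 < R) (hr : 0 ≤ r) :
    Real.cos (α * θ) * ‖ray θ R r‖ ^ α ≤ (ray θ R r ^ (α : ℂ)).re := by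
  rw [Complex.cpow_ofReal_re, mul_comm]
  refine mul_le_mul_of_nonneg_left ?_ (by positivity)
  have h0 := arg_ray_nonneg (R := R) hr h.sin_pos.le
  have h1 := arg_ray_le h hR hr
  refine Real.cos_le_cos_of_nonneg_of_le_pi (mul_nonneg h0 h.pos.le) ?_ ?_
  · linarith [h.mul_lt, Real.pi_pos]
  · rw [mul_comm]; exact mul_le_mul_of_nonneg_left h1 h.pos.le

theorem continuous_ray (θ R : ℝ) : Continuous (ray θ R) := by
  unfold ray; fun_prop

/-! ### A growth estimate and the Gamma integral with complex scale. -/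

/-- `exp (S x ^ α) x ^ p` is of exponential growth with arbitrarily small rate. -/
theorem exists_exp_mul_rpow_le {α : ℝ} (h1 : α < 1) (S p : ℝ) {x₀ c : ℝ}
    (hx₀ : 0 < x₀) (hc : 0 < c) :
    ∃ C, 0 < C ∧ ∀ x, x₀ ≤ x → Real.exp (S * x ^ α) * x ^ p ≤ C * Real.exp (c * x) := by
  have hA : ∀ᶠ x : ℝ in atTop, S * x ^ α ≤ c / 2 * x := by
    have h2 : Tendsto (fun x : ℝ => S * x ^ (-(1 - α))) atTop (𝓝 (S * 0)) :=
      (tendsto_rpow_neg_atTop (by linarith)).const_mul S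
    rw [mul_zero] at h2
    filter_upwards [h2.eventually_le_const (half_pos hc), eventually_gt_atTop 0] with x hx hx0
    have h3 : x ^ α = x ^ (-(1 - α)) * x := by
      rw [← Real.rpow_add_one hx0.ne']; ring_nf
    rw [h3, ← mul_assoc]
    gcongr
  have hB : ∀ᶠ x : ℝ in atTop, x ^ p ≤ Real.exp (c / 2 * x) := by
    filter_upwards [(isLittleO_rpow_exp_pos_mul_atTop p (half_pos hc)).bound one_pos] with x hx
    rw [one_mul, Real.norm_eq_abs, Real.norm_of_nonneg (Real.exp_pos _).le] at hx
    exact (le_abs_self _).trans hx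
  obtain ⟨X, hX⟩ := (hA.and hB).exists_forall_of_atTop
  have hcont : ContinuousOn (fun x : ℝ => Real.exp (S * x ^ α) * x ^ p) (Icc x₀ X) := by
    have hne : ∀ x ∈ Icc x₀ X, x ≠ 0 := fun x hx => (hx₀.trans_le hx.1).ne'
    refine ContinuousOn.mul (ContinuousOn.rexp (continuousOn_const.mul ?_)) ?_
    · exact continuousOn_id.rpow_const fun x hx => Or.inl (hne x hx)
    · exact continuousOn_id.rpow_const fun x hx => Or.inl (hne x hx)
  obtain ⟨C, hC⟩ := isCompact_Icc.exists_bound_of_continuousOn hcont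
  refine ⟨max C 1, by positivity, fun x hx => ?_⟩
  have hx0 := hx₀.trans_le hx
  rcases le_total x X with h | h
  · have h2 := (le_abs_self _).trans (hC x ⟨hx, h⟩)
    have h3 : 1 ≤ Real.exp (c * x) := Real.one_le_exp (by positivity)
    calc _ ≤ max C 1 := h2.trans (le_max_left _ _)
      _ ≤ _ := le_mul_of_one_le_right (by positivity) h3
  · obtain ⟨h2, h3⟩ := hX x h
    calc _ ≤ Real.exp (c / 2 * x) * Real.exp (c / 2 * x) := by gcongr
      _ = Real.exp (c * x) := by rw [← Real.exp_add]; ring_nf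
      _ ≤ _ := le_mul_of_one_le_left (by positivity) (le_max_right _ _)

/-- Gamma integral with a complex scale. -/
theorem integral_rpow_mul_cexp_neg_mul {a : ℝ} (ha : 0 < a) {z : ℂ} (hz : 0 < z.re) :
    ∫ v in Ioi (0 : ℝ), ((v ^ (a - 1) : ℝ) : ℂ) * Complex.exp (-(v * z))
      = Real.Gamma a * z ^ (-(a : ℂ)) := by
  have hopen : IsOpen {z : ℂ | 0 < z.re} := isOpen_lt continuous_const Complex.continuous_re
  have hmeas : ∀ (b : ℝ) (w : ℂ), AEStronglyMeasurable
      (fun v : ℝ => ((v ^ b : ℝ) : ℂ) * Complex.exp (-(v * w))) (volume.restrict (Ioi 0)) :=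
    fun b w => (Measurable.aestronglyMeasurable (by fun_prop))
  have hint : ∀ {b c : ℝ}, -1 < b → 0 < c →
      IntegrableOn (fun v : ℝ => v ^ b * Real.exp (-c * v)) (Ioi 0) := by
    intro b c hb hc
    simpa using integrableOn_rpow_mul_exp_neg_mul_rpow hb one_pos hc
  have hnorm : ∀ (b : ℝ) (w : ℂ) (v : ℝ), 0 < v →
      ‖((v ^ b : ℝ) : ℂ) * Complex.exp (-(v * w))‖ = v ^ b * Real.exp (-w.re * v) := by
    intro b w v hv
    rw [norm_mul, Complex.norm_real, Complex.norm_exp, Real.norm_of_nonneg (by positivity)]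
    simp [mul_comm]
  have hderiv : ∀ w : ℂ, 0 < w.re → DifferentiableAt ℂ (fun w : ℂ =>
      ∫ v in Ioi (0 : ℝ), ((v ^ (a - 1) : ℝ) : ℂ) * Complex.exp (-(v * w))) w := by
    intro w hw
    have hnhds : {x : ℂ | w.re / 2 < x.re} ∈ 𝓝 w :=
      (isOpen_lt continuous_const Complex.continuous_re).mem_nhds (by simp; linarith)
    refine (hasDerivAt_integral_of_dominated_loc_of_deriv_le
      (F' := fun x (v : ℝ) => -(((v ^ a : ℝ) : ℂ) * Complex.exp (-(v * x))))
      (bound := fun v => v ^ a * Real.exp (-(w.re / 2) * v)) hnhds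
      (.of_forall fun x => hmeas _ _) ?_ (hmeas _ _).neg ?_
      (hint (by linarith) (by linarith)) ?_).2.differentiableAt
    · refine (hint (b := a - 1) (by linarith) hw).mono' (hmeas _ _) ?_
      filter_upwards [ae_restrict_mem measurableSet_Ioi] with v hv
      exact (hnorm _ _ v hv).le
    · filter_upwards [ae_restrict_mem measurableSet_Ioi] with v hv x hx
      rw [mem_Ioi] at hv
      rw [norm_neg, hnorm _ _ v hv]
      have : w.re / 2 < x.re := hx
      gcongr
    · filter_upwards [ae_restrict_mem measurableSet_Ioi] with v hv x hx
      rw [mem_Ioi] at hv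
      have h1 : HasDerivAt (fun x : ℂ => Complex.exp (-(v * x)))
          (Complex.exp (-(v * x)) * (-(v * 1))) x :=
        (((hasDerivAt_id x).const_mul (v : ℂ)).neg).cexp
      refine (h1.const_mul ((v ^ (a - 1) : ℝ) : ℂ)).congr_deriv ?_
      have h2 : v ^ a = v ^ (a - 1) * v := by rw [← Real.rpow_add_one hv.ne']; ring_nf
      rw [h2]
      push_cast
      ring
  have hA : AnalyticOnNhd ℂ (fun w : ℂ => ∫ v in Ioi (0 : ℝ),
      ((v ^ (a - 1) : ℝ) : ℂ) * Complex.exp (-(v * w))) {z : ℂ | 0 < z.re} :=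
    DifferentiableOn.analyticOnNhd (fun w hw => (hderiv w hw).differentiableWithinAt) hopen
  have hB : AnalyticOnNhd ℂ (fun w : ℂ => Real.Gamma a * w ^ (-(a : ℂ))) {z : ℂ | 0 < z.re} := by
    refine DifferentiableOn.analyticOnNhd (fun w hw => ?_) hopen
    refine DifferentiableAt.differentiableWithinAt ?_
    exact (differentiableAt_id.cpow_const
      (Complex.mem_slitPlane_iff.2 (Or.inl hw))).const_mul _
  -- Identity theorem: both sides are analytic in the right half-plane and agree on the positive
  -- reals, which accumulate at `1`.
  refine hA.eqOn_of_preconnected_of_frequently_eq hB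
    (convex_halfSpace_re_gt 0).isPreconnected (z₀ := 1) (by simp) ?_ hz
  have hreal : ∀ x : ℝ, 0 < x → ∫ v in Ioi (0 : ℝ),
      ((v ^ (a - 1) : ℝ) : ℂ) * Complex.exp (-(v * (x : ℂ))) = Real.Gamma a * (x : ℂ) ^ (-(a : ℂ)) := by
    intro x hx
    have := Real.integral_rpow_mul_exp_neg_mul_Ioi ha hx
    rw [one_div, Real.inv_rpow hx.le, ← Real.rpow_neg hx.le] at this
    rw [← Complex.ofReal_neg, ← Complex.ofReal_cpow hx.le, ← Complex.ofReal_mul,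
      mul_comm (Real.Gamma a), ← this, ← integral_complex_ofReal]
    refine integral_congr_ae (.of_forall fun v => ?_)
    simp [mul_comm]
  have hfreq : ∃ᶠ x : ℝ in 𝓝[≠] 1, 0 < x := by
    refine Eventually.frequently ?_
    exact nhdsWithin_le_nhds (lt_mem_nhds one_pos)
  have htend : Tendsto (fun x : ℝ => (x : ℂ)) (𝓝[≠] 1) (𝓝[≠] 1) := by
    refine tendsto_nhdsWithin_of_tendsto_nhds_of_eventually_within _ ?_ ?_
    · exact (Complex.continuous_ofReal.tendsto' 1 1 (by simp)).mono_left nhdsWithin_le_nhds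
    · filter_upwards [self_mem_nhdsWithin] with x hx
      simpa using hx
  exact htend.frequently (hfreq.mono fun x hx => hreal x hx)

/-! ### Hankel integrals at `s = 0` and the formula for `1 / Γ`. -/

/-- The integrand of the Hankel representation of `t ^ (δ - 1) W_{-α,δ}(-s / t ^ α)`. -/
noncomputable def hankelKernel (α δ s t : ℝ) (z : ℂ) : ℂ :=
  Complex.exp (t * z - s * z ^ (α : ℂ)) * z ^ (-(δ : ℂ))

/-- The integral of `hankelKernel` along a ray. -/
noncomputable def hankelIntegral (α θ R δ s t : ℝ) : ℂ :=
  ∫ r in Ioi (0 : ℝ), Complex.exp (θ * Complex.I) * hankelKernel α δ s t (ray θ R r)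

theorem norm_hankelKernel (α δ s t : ℝ) (z : ℂ) : ‖hankelKernel α δ s t z‖ =
    Real.exp (t * z.re - s * (z ^ (α : ℂ)).re) * ‖z‖ ^ (-δ) := by
  rw [hankelKernel, norm_mul, Complex.norm_exp, ← Complex.ofReal_neg, Complex.norm_cpow_real]
  simp

theorem measurable_hankelKernel_ray (α δ s t θ R : ℝ) :
    Measurable fun r => hankelKernel α δ s t (ray θ R r) := by
  unfold hankelKernel
  have := (continuous_ray θ R).measurable
  fun_prop

theorem norm_hankelKernel_zero_ray (α δ t θ R r : ℝ) : ‖hankelKernel α δ 0 t (ray θ R r)‖ =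
    Real.exp (t * (R + r * Real.cos θ)) * ‖ray θ R r‖ ^ (-δ) := by
  rw [norm_hankelKernel, ray_re]; simp

/-- Along the ray `exp(t Re z)` decays at rate `t |cos θ|`. Half of this rate absorbs `exp(S ‖z‖^α)
‖z‖^(-δ)`, since `α < 1`; the other half remains as `c`. Uniformity in `R` serves to differentiate
in the tip, the factor with `S` to expand or differentiate in `s`. -/
theorem exists_exp_mul_norm_hankelKernel_ray_le {α θ : ℝ} (h : IsHankelAngle α θ) (δ S : ℝ)
    {t R₀ R₁ : ℝ} (ht : 0 < t) (hR₀ : 0 < R₀) :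
    ∃ C c, 0 < C ∧ 0 < c ∧ ∀ R r, R₀ ≤ R → R ≤ R₁ → 0 ≤ r →
      Real.exp (S * ‖ray θ R r‖ ^ α) * ‖hankelKernel α δ 0 t (ray θ R r)‖
        ≤ C * Real.exp (-c * r) := by
  have hκ := h.cos_neg
  set c := t * -Real.cos θ / 2 with hc
  have hc0 : 0 < c := by have := mul_pos ht (neg_pos.2 hκ); positivity
  obtain ⟨C, hC0, hC⟩ := exists_exp_mul_rpow_le h.lt_one S (-δ)
    (mul_pos hR₀ h.sin_pos) hc0
  refine ⟨C * Real.exp ((c + t) * R₁), c, by positivity, hc0, fun R r hR hR1 hr => ?_⟩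
  have hR0 := hR₀.trans_le hR
  have h1 : R₀ * Real.sin θ ≤ ‖ray θ R r‖ :=
    (mul_le_mul_of_nonneg_right hR h.sin_pos.le).trans (le_norm_ray_left θ R r)
  have h2 := hC _ h1
  have h4 := norm_ray_le (θ := θ) hR0.le hr
  rw [norm_hankelKernel_zero_ray]
  calc _ = Real.exp (t * (R + r * Real.cos θ)) *
        (Real.exp (S * ‖ray θ R r‖ ^ α) * ‖ray θ R r‖ ^ (-δ)) := by ring
    _ ≤ Real.exp (t * (R + r * Real.cos θ)) * (C * Real.exp (c * (R + r))) := by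
        exact mul_le_mul_of_nonneg_left (h2.trans (by gcongr)) (Real.exp_pos _).le
    _ = C * Real.exp ((c + t) * R + -c * r) := by
        rw [mul_left_comm, ← Real.exp_add, hc]; ring_nf
    _ ≤ C * Real.exp ((c + t) * R₁ + -c * r) := by gcongr
    _ = _ := by rw [Real.exp_add]; ring

theorem norm_hankelKernel_eq (α δ s t : ℝ) (z : ℂ) : ‖hankelKernel α δ s t z‖ =
    Real.exp (-s * (z ^ (α : ℂ)).re) * ‖hankelKernel α δ 0 t z‖ := by
  rw [norm_hankelKernel, norm_hankelKernel, ← mul_assoc, ← Real.exp_add]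
  ring_nf

theorem exists_norm_hankelKernel_ray_le {α θ : ℝ} (h : IsHankelAngle α θ) (δ S : ℝ) {t R₀ R₁ : ℝ}
    (ht : 0 < t) (hR₀ : 0 < R₀) :
    ∃ C c, 0 < C ∧ 0 < c ∧ ∀ R r s, R₀ ≤ R → R ≤ R₁ → 0 ≤ r → |s| ≤ S →
      ‖hankelKernel α δ s t (ray θ R r)‖ ≤ C * Real.exp (-c * r) := by
  obtain ⟨C, c, hC0, hc, hC⟩ := exists_exp_mul_norm_hankelKernel_ray_le h δ S (R₁ := R₁) ht hR₀
  refine ⟨C, c, hC0, hc, fun R r s hR hR1 hr hs => le_trans ?_ (hC R r hR hR1 hr)⟩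
  rw [norm_hankelKernel_eq, ← Complex.norm_cpow_real]
  refine mul_le_mul_of_nonneg_right (Real.exp_le_exp.2 ?_) (norm_nonneg _)
  calc _ ≤ |-s * (ray θ R r ^ (α : ℂ)).re| := le_abs_self _
    _ = |s| * |(ray θ R r ^ (α : ℂ)).re| := by rw [abs_mul, abs_neg]
    _ ≤ _ := mul_le_mul hs (Complex.abs_re_le_norm _) (abs_nonneg _) ((abs_nonneg _).trans hs)

theorem norm_cexp_mul_I_mul (θ : ℝ) (z : ℂ) : ‖Complex.exp (θ * Complex.I) * z‖ = ‖z‖ := by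
  rw [norm_mul, Complex.norm_exp_ofReal_mul_I, one_mul]

theorem integrableOn_hankelKernel_ray {α θ : ℝ} (h : IsHankelAngle α θ) (δ s : ℝ) {t R : ℝ}
    (ht : 0 < t) (hR : 0 < R) :
    IntegrableOn (fun r => hankelKernel α δ s t (ray θ R r)) (Ioi 0) := by
  obtain ⟨C, c, -, hc, hC⟩ := exists_norm_hankelKernel_ray_le h δ |s| (R₁ := R) ht hR
  refine ((exp_neg_integrableOn_Ioi 0 hc).const_mul C).mono'
    (measurable_hankelKernel_ray ..).aestronglyMeasurable ?_
  filter_upwards [ae_restrict_mem measurableSet_Ioi] with r hr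
  exact hC R r s le_rfl le_rfl (le_of_lt hr) le_rfl

theorem hasDerivAt_hankelKernel_zero (α δ t : ℝ) {z : ℂ} (hz : z ∈ Complex.slitPlane) :
    HasDerivAt (hankelKernel α δ 0 t)
      (t * hankelKernel α δ 0 t z - δ * hankelKernel α (δ + 1) 0 t z) z := by
  have hz0 := Complex.slitPlane_ne_zero hz
  have h1 : HasDerivAt (fun z : ℂ => Complex.exp (t * z)) (Complex.exp (t * z) * (t * 1)) z :=
    ((hasDerivAt_id z).const_mul (t : ℂ)).cexp
  have h2 : HasDerivAt (fun z : ℂ => z ^ (-(δ : ℂ))) (-(δ : ℂ) * z ^ (-(δ : ℂ) - 1) * 1) z :=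
    (hasDerivAt_id z).cpow_const hz
  have h3 := h1.mul h2
  have h4 : hankelKernel α δ 0 t = fun z : ℂ => Complex.exp (t * z) * z ^ (-(δ : ℂ)) := by
    ext z; simp [hankelKernel]
  rw [h4]
  refine h3.congr_deriv ?_
  simp only [hankelKernel]
  push_cast
  rw [neg_add, ← sub_eq_add_neg]
  simp
  ring

/-- Cauchy's theorem in differential form: along the ray `∂_r K = ω ∂_R K`, so the `R`-derivative of
the integral is the integral of `∂_r K`, and only the value at the tip survives. -/
theorem hasDerivAt_hankelIntegral {α θ : ℝ} (h : IsHankelAngle α θ) (δ : ℝ) {t R : ℝ}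
    (ht : 0 < t) (hR : 0 < R) :
    HasDerivAt (fun R => hankelIntegral α θ R δ 0 t) (-hankelKernel α δ 0 t R) R := by
  set ω := Complex.exp (θ * Complex.I) with hω
  obtain ⟨C, c, hC0, hc, hC⟩ := exists_norm_hankelKernel_ray_le h δ 0 (R₀ := R / 2)
    (R₁ := 2 * R) ht (half_pos hR)
  obtain ⟨C', c', hC0', hc', hC'⟩ := exists_norm_hankelKernel_ray_le h (δ + 1) 0 (R₀ := R / 2)
    (R₁ := 2 * R) ht (half_pos hR)
  let K' : ℂ → ℂ := fun z => t * hankelKernel α δ 0 t z - δ * hankelKernel α (δ + 1) 0 t z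
  have hmeas : ∀ R, AEStronglyMeasurable (fun r => ω * hankelKernel α δ 0 t (ray θ R r))
      (volume.restrict (Ioi 0)) := fun R =>
    ((measurable_hankelKernel_ray ..).const_mul _).aestronglyMeasurable
  have hint : IntegrableOn (fun r => ω * K' (ray θ R r)) (Ioi 0) := by
    refine Integrable.const_mul (Integrable.sub ?_ ?_) ω
    · exact (integrableOn_hankelKernel_ray h δ 0 ht hR).const_mul _
    · exact (integrableOn_hankelKernel_ray h (δ + 1) 0 ht hR).const_mul _
  have key := hasDerivAt_integral_of_dominated_loc_of_deriv_le
    (F := fun R r => ω * hankelKernel α δ 0 t (ray θ R r)) (x₀ := R)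
    (F' := fun R r => ω * K' (ray θ R r)) (μ := volume.restrict (Ioi 0))
    (bound := fun r => t * (C * Real.exp (-c * r)) + |δ| * (C' * Real.exp (-c' * r)))
    (s := Icc (R / 2) (2 * R)) (Icc_mem_nhds (by linarith) (by linarith))
    (.of_forall hmeas) ((integrableOn_hankelKernel_ray h δ 0 ht hR).const_mul ω)
    hint.aestronglyMeasurable ?_ ?_ ?_
  · refine key.2.congr_deriv ?_
    have htend : Tendsto (fun r => hankelKernel α δ 0 t (ray θ R r)) atTop (𝓝 0) := by
      have h0 : Tendsto (fun r : ℝ => C * Real.exp (-c * r)) atTop (𝓝 0) := by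
        have : Tendsto (fun r : ℝ => Real.exp (-c * r)) atTop (𝓝 0) :=
          Real.tendsto_exp_atBot.comp (tendsto_id.const_mul_atTop_of_neg (by linarith))
        simpa using this.const_mul C
      refine squeeze_zero_norm' ?_ h0
      filter_upwards [eventually_ge_atTop 0] with r hr
      exact hC R r 0 (by linarith) (by linarith) hr (by simp)
    have hd : ∀ r ∈ Ici (0 : ℝ), HasDerivAt (fun r => hankelKernel α δ 0 t (ray θ R r))
        (ω * K' (ray θ R r)) r := by
      intro r hr
      have h1 : HasDerivAt (ray θ R) ω r := by
        have := ((hasDerivAt_id r).ofReal_comp.mul_const ω).const_add (R : ℂ)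
        exact this.congr_deriv (by simp)
      have h2 := (hasDerivAt_hankelKernel_zero α δ t
        (ray_mem_slitPlane hR hr h.sin_pos)).comp r h1
      rw [mul_comm]
      exact h2
    have h3 := integral_Ioi_of_hasDerivAt_of_tendsto' hd hint htend
    rw [h3]
    simp [ray]
  · filter_upwards [ae_restrict_mem measurableSet_Ioi] with r hr x hx
    rw [norm_cexp_mul_I_mul]
    refine (norm_sub_le _ _).trans ?_
    rw [norm_mul, norm_mul, Complex.norm_real, Complex.norm_real, Real.norm_of_nonneg ht.le,
      Real.norm_eq_abs]
    have h1 := hC x r 0 hx.1 hx.2 (le_of_lt hr) (by simp)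
    have h2 := hC' x r 0 hx.1 hx.2 (le_of_lt hr) (by simp)
    gcongr
  · exact (((exp_neg_integrableOn_Ioi 0 hc).const_mul C).const_mul t).add
      (((exp_neg_integrableOn_Ioi 0 hc').const_mul C').const_mul |δ|)
  · filter_upwards [ae_restrict_mem measurableSet_Ioi] with r hr x hx
    have hx0 : 0 < x := by linarith [hx.1]
    have h1 : HasDerivAt (fun x => ray θ x r) 1 x := by
      have := (hasDerivAt_id x).ofReal_comp.add_const (r * ω)
      exact this.congr_deriv (by simp)
    have h2 := (hasDerivAt_hankelKernel_zero α δ t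
        (ray_mem_slitPlane hx0 (le_of_lt hr) h.sin_pos)).comp x h1
    rw [mul_one] at h2
    exact h2.const_mul ω

/-- The part of the Hankel integral that matters does not depend on the tip of the contour. -/
theorem hankelIntegral_im_eq {α θ : ℝ} (h : IsHankelAngle α θ) (δ : ℝ) {t R R' : ℝ}
    (ht : 0 < t) (hR : 0 < R) (hR' : 0 < R') :
    (hankelIntegral α θ R δ 0 t).im = (hankelIntegral α θ R' δ 0 t).im := by
  have hd : ∀ x ∈ Ioi (0 : ℝ), HasDerivAt (fun R => (hankelIntegral α θ R δ 0 t).im) 0 x := by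
    intro x hx
    have h1 := (Complex.imCLM.hasFDerivAt.comp_hasDerivAt x (hasDerivAt_hankelIntegral h δ ht hx))
    refine h1.congr_deriv ?_
    have hx' : (0 : ℝ) ≤ x := le_of_lt hx
    -- The kernel is real on the positive axis, so moving the tip changes only the real part of the
    -- integral.
    have : hankelKernel α δ 0 t x = ((Real.exp (t * x) * x ^ (-δ) : ℝ) : ℂ) := by
      simp [hankelKernel, Complex.ofReal_cpow hx']
    simp only [map_neg, Complex.imCLM_apply, this, Complex.ofReal_im, neg_zero]
  exact isOpen_Ioi.is_const_of_deriv_eq_zero isPreconnected_Ioi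
    (fun x hx => (hd x hx).differentiableAt.differentiableWithinAt)
    (fun x hx => (hd x hx).deriv) hR hR'

/-- The tip can be contracted to the origin because `r^(-δ)` is integrable there when `δ < 1`. -/
theorem tendsto_hankelIntegral_zero {α θ : ℝ} (h : IsHankelAngle α θ) {δ t : ℝ} (hδ : δ < 1)
    (ht : 0 < t) :
    Tendsto (fun R => hankelIntegral α θ R δ 0 t) (𝓝[>] 0) (𝓝 (hankelIntegral α θ 0 δ 0 t)) := by
  have hm := h.sin_pos
  have hκ : 0 < t * -Real.cos θ := mul_pos ht (neg_pos.2 h.cos_neg)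
  obtain ⟨C, hC0, hC⟩ := exists_exp_mul_rpow_le h.lt_one 0 (-δ) one_pos (half_pos hκ)
  have hmem : ∀ᶠ R : ℝ in 𝓝[>] 0, R ∈ Ioo (0 : ℝ) 1 := Ioo_mem_nhdsGT one_pos
  refine tendsto_integral_filter_of_dominated_convergence
    (fun r => Real.exp t * Real.sin θ ^ (-δ) * (r ^ (-δ) * Real.exp (-(t * -Real.cos θ) * r)) +
      Real.exp t * (C * Real.exp (t * -Real.cos θ / 2)) *
        Real.exp (-(t * -Real.cos θ / 2) * r)) ?_ ?_ ?_ ?_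
  · exact .of_forall fun R => ((measurable_hankelKernel_ray ..).const_mul _).aestronglyMeasurable
  · filter_upwards [hmem] with R hR
    filter_upwards [ae_restrict_mem measurableSet_Ioi] with r hr
    rw [mem_Ioi] at hr
    rw [norm_cexp_mul_I_mul, norm_hankelKernel_zero_ray]
    have h1 := le_norm_ray_right θ R r
    have h2 := norm_ray_le (θ := θ) hR.1.le hr.le
    have h3 : ‖ray θ R r‖ ≤ 1 + r := by linarith [hR.2]
    have h0 : 0 < r * Real.sin θ := by positivity
    -- The sign of `δ` decides whether the lower or the upper bound for `‖z‖` applies; the sum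
    -- covers both cases.
    have h4 : ‖ray θ R r‖ ^ (-δ) ≤ (r * Real.sin θ) ^ (-δ) + (1 + r) ^ (-δ) := by
      rcases le_total 0 δ with hd | hd
      · exact (Real.rpow_le_rpow_of_nonpos h0 h1 (by linarith)).trans
          (le_add_of_nonneg_right (by positivity))
      · exact (Real.rpow_le_rpow (norm_nonneg _) h3 (by linarith)).trans
          (le_add_of_nonneg_left (by positivity))
    have h5 := hC (1 + r) (by linarith)
    rw [zero_mul, Real.exp_zero, one_mul] at h5
    calc Real.exp (t * (R + r * Real.cos θ)) * ‖ray θ R r‖ ^ (-δ)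
        ≤ Real.exp (t * (1 + r * Real.cos θ)) * ((r * Real.sin θ) ^ (-δ) +
          C * Real.exp (t * -Real.cos θ / 2 * (1 + r))) := by
          gcongr
          · exact hR.2.le
          · linarith
      _ = _ := by
          rw [Real.mul_rpow hr.le hm.le, mul_add,
            show t * (1 + r * Real.cos θ) = t + -(t * -Real.cos θ) * r by ring, Real.exp_add]
          congr 1
          · ring
          · rw [show t * -Real.cos θ / 2 * (1 + r) = t * -Real.cos θ / 2 +
              (t * -Real.cos θ) * r + -(t * -Real.cos θ / 2) * r by ring, Real.exp_add,
              Real.exp_add, neg_mul, Real.exp_neg]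
            field_simp
  · refine Integrable.add (Integrable.const_mul ?_ _) (Integrable.const_mul ?_ _)
    · have := integrableOn_rpow_mul_exp_neg_mul_rpow (s := -δ) (by linarith) one_pos hκ
      simp only [Real.rpow_one] at this
      exact this
    · exact exp_neg_integrableOn_Ioi 0 (half_pos hκ)
  · filter_upwards [ae_restrict_mem measurableSet_Ioi] with r hr
    rw [mem_Ioi] at hr
    have hmem0 : ray θ 0 r ∈ Complex.slitPlane := by
      rw [Complex.mem_slitPlane_iff, ray_im]; right; positivity
    have hc : ContinuousAt (fun R => ray θ R r) 0 := by unfold ray; fun_prop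
    have h1 : ContinuousAt (fun R => Complex.exp (θ * Complex.I) *
        hankelKernel α δ 0 t (ray θ R r)) 0 := by
      have h2 := (hasDerivAt_hankelKernel_zero α δ t hmem0).continuousAt
      exact continuousAt_const.mul (ContinuousAt.comp (f := fun R => ray θ R r) h2 hc)
    exact h1.tendsto.mono_left nhdsWithin_le_nhds

theorem polar_cpow {r φ : ℝ} (hr : 0 < r) (h1 : -Real.pi < φ) (h2 : φ ≤ Real.pi) (p : ℝ) :
    ((r : ℂ) * Complex.exp (φ * Complex.I)) ^ (p : ℂ) =
      ((r ^ p : ℝ) : ℂ) * Complex.exp ((φ * p : ℝ) * Complex.I) := by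
  rw [Complex.cpow_def_of_ne_zero (mul_ne_zero (Complex.ofReal_ne_zero.2 hr.ne')
    (Complex.exp_ne_zero _)), Complex.log_ofReal_mul hr (Complex.exp_ne_zero _),
    Complex.log_exp (by simpa using h1) (by simpa using h2), Real.rpow_def_of_pos hr, add_mul,
    Complex.exp_add]
  push_cast
  ring_nf

/-- With its tip at the origin the integral is a Gamma integral with scale `-t exp(iθ)`, whose real
part is positive because `θ > π/2`; it is written with angle `θ - π` to stay on the principal
branch. The angle `θ` then cancels, leaving `Γ(1-δ) t^(δ-1) exp(iπ(1-δ))`, and the reflection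
formula finishes. -/
theorem hankelIntegral_zero_im {α θ : ℝ} (h : IsHankelAngle α θ) {δ t : ℝ} (hδ : δ < 1)
    (ht : 0 < t) :
    (hankelIntegral α θ 0 δ 0 t).im = Real.pi * (t ^ (δ - 1) / Real.Gamma δ) := by
  have hπ := Real.pi_pos
  set z : ℂ := (t : ℂ) * Complex.exp ((θ - Real.pi : ℝ) * Complex.I) with hz
  have hzw : z = -(t * Complex.exp (θ * Complex.I)) := by
    rw [hz]; push_cast
    rw [sub_mul, Complex.exp_sub, Complex.exp_pi_mul_I]; ring
  have hzre : 0 < z.re := by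
    rw [hzw]; simp [Complex.exp_ofReal_mul_I_re]
    exact mul_neg_of_pos_of_neg ht h.cos_neg
  have hG := integral_rpow_mul_cexp_neg_mul (a := 1 - δ) (by linarith) hzre
  have hint : hankelIntegral α θ 0 δ 0 t =
      Complex.exp ((θ * (1 - δ) : ℝ) * Complex.I) *
        (Real.Gamma (1 - δ) * z ^ (-((1 - δ : ℝ) : ℂ))) := by
    rw [← hG, hankelIntegral, ← integral_const_mul]
    refine setIntegral_congr_fun measurableSet_Ioi fun r hr => ?_
    rw [mem_Ioi] at hr
    have h1 : ray θ 0 r ^ (-(δ : ℂ)) = ((r ^ (-δ) : ℝ) : ℂ) *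
        Complex.exp ((-(θ * δ) : ℝ) * Complex.I) := by
      have h2 : ray θ 0 r = r * Complex.exp (θ * Complex.I) := by simp [ray]
      rw [h2, ← Complex.ofReal_neg, polar_cpow hr (by linarith [h.gt]) h.lt.le]
      ring_nf
    simp only [hankelKernel]
    rw [h1, hzw]
    have h3 : Complex.exp (t * ray θ 0 r - (0 : ℝ) * ray θ 0 r ^ (α : ℂ)) =
        Complex.exp (-(r * -(t * Complex.exp (θ * Complex.I)))) := by
      congr 1; simp [ray]; ring
    rw [h3, show 1 - δ - 1 = -δ by ring]
    have h4 : Complex.exp ((θ * (1 - δ) : ℝ) * Complex.I) = Complex.exp (θ * Complex.I) *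
        Complex.exp ((-(θ * δ) : ℝ) * Complex.I) := by
      rw [← Complex.exp_add]; congr 1; push_cast; ring
    rw [h4]; ring
  have hzp : z ^ (-((1 - δ : ℝ) : ℂ)) = ((t ^ (δ - 1) : ℝ) : ℂ) *
      Complex.exp (((Real.pi - θ) * (1 - δ) : ℝ) * Complex.I) := by
    rw [hz, ← Complex.ofReal_neg, polar_cpow ht (by linarith [h.gt]) (by linarith [h.lt])]
    ring_nf
  have h5 : hankelIntegral α θ 0 δ 0 t =
      ((Real.Gamma (1 - δ) * t ^ (δ - 1) : ℝ) : ℂ) *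
        Complex.exp ((Real.pi * (1 - δ) : ℝ) * Complex.I) := by
    have h6 : Complex.exp ((Real.pi * (1 - δ) : ℝ) * Complex.I) =
        Complex.exp ((θ * (1 - δ) : ℝ) * Complex.I) *
        Complex.exp (((Real.pi - θ) * (1 - δ) : ℝ) * Complex.I) := by
      rw [← Complex.exp_add]; congr 1; push_cast; ring
    rw [hint, hzp, h6]; push_cast; ring
  rw [h5, Complex.im_ofReal_mul, Complex.exp_ofReal_mul_I_im]
  have h7 : Real.sin (Real.pi * (1 - δ)) = Real.sin (Real.pi * δ) := by
    rw [← Real.sin_pi_sub]; ring_nf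
  have h8 := Real.Gamma_mul_Gamma_one_sub δ
  have h9 : 0 < Real.Gamma (1 - δ) := Real.Gamma_pos_of_pos (by linarith)
  rw [h7]
  -- Here `δ` is a pole of `Γ`: the default value `Real.Gamma δ = 0` makes both sides vanish.
  by_cases hs : Real.sin (Real.pi * δ) = 0
  · rw [hs, div_zero] at h8
    have : Real.Gamma δ = 0 := by simpa [h9.ne'] using h8
    rw [hs, this]; simp
  · have h10 : Real.Gamma δ ≠ 0 := by
      intro h0; rw [h0, zero_mul, eq_comm, div_eq_zero_iff] at h8
      exact h8.elim hπ.ne' hs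
    rw [eq_div_iff hs] at h8
    rw [mul_div_assoc', eq_div_iff h10]
    linear_combination t ^ (δ - 1) * h8

/-- Hankel's formula for `1 / Γ`. -/
theorem hankelIntegral_im_of_lt {α θ : ℝ} (h : IsHankelAngle α θ) {δ t R : ℝ} (hδ : δ < 1)
    (ht : 0 < t) (hR : 0 < R) :
    (hankelIntegral α θ R δ 0 t).im = Real.pi * (t ^ (δ - 1) / Real.Gamma δ) := by
  rw [← hankelIntegral_zero_im h hδ ht]
  have h1 := (Complex.continuous_im.tendsto _).comp (tendsto_hankelIntegral_zero h hδ ht)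
  refine tendsto_nhds_unique (tendsto_const_nhds.congr' ?_) h1
  filter_upwards [self_mem_nhdsWithin] with x hx
  exact hankelIntegral_im_eq h δ ht hR hx

/-- At `δ = 1` the tip cannot be contracted to the origin; instead `δ` increases to `1` with `R > 0`
fixed, where `‖z‖^(-δ)` is dominated by its values at the exponents `0` and `-1`. The endpoint is
needed because `W_{-α,1}` gives the primitive of the density. -/
theorem hankelIntegral_im {α θ : ℝ} (h : IsHankelAngle α θ) {δ t R : ℝ} (hδ : δ ≤ 1)
    (ht : 0 < t) (hR : 0 < R) :
    (hankelIntegral α θ R δ 0 t).im = Real.pi * (t ^ (δ - 1) / Real.Gamma δ) := by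
  rcases hδ.lt_or_eq with hδ | rfl
  · exact hankelIntegral_im_of_lt h hδ ht hR
  have hlim : Tendsto (fun δ => hankelIntegral α θ R δ 0 t) (𝓝[<] 1)
      (𝓝 (hankelIntegral α θ R 1 0 t)) := by
    refine tendsto_integral_filter_of_dominated_convergence
      (fun r => ‖hankelKernel α 0 0 t (ray θ R r)‖ + ‖hankelKernel α 1 0 t (ray θ R r)‖)
      ?_ ?_ ?_ ?_
    · exact .of_forall fun δ =>
        ((measurable_hankelKernel_ray ..).const_mul _).aestronglyMeasurable
    · filter_upwards [Ioo_mem_nhdsLT one_pos] with δ hδ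
      filter_upwards [ae_restrict_mem measurableSet_Ioi] with r hr
      rw [norm_cexp_mul_I_mul]
      simp only [norm_hankelKernel_zero_ray, ← mul_add]
      have hpos : 0 < ‖ray θ R r‖ := norm_pos_iff.2
        (Complex.slitPlane_ne_zero (ray_mem_slitPlane hR (le_of_lt hr) h.sin_pos))
      refine mul_le_mul_of_nonneg_left ?_ (Real.exp_pos _).le
      rcases le_total ‖ray θ R r‖ 1 with h1 | h1
      · exact (Real.rpow_le_rpow_of_exponent_ge hpos h1 (by linarith [hδ.2])).trans
          (le_add_of_nonneg_left (by positivity))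
      · exact (Real.rpow_le_rpow_of_exponent_le h1 (by linarith [hδ.1])).trans
          (le_add_of_nonneg_right (by positivity))
    · exact (integrableOn_hankelKernel_ray h 0 0 ht hR).norm.add
        (integrableOn_hankelKernel_ray h 1 0 ht hR).norm
    · filter_upwards [ae_restrict_mem measurableSet_Ioi] with r hr
      have hne := Complex.slitPlane_ne_zero (ray_mem_slitPlane hR (le_of_lt hr) h.sin_pos)
      have : Continuous fun δ : ℝ => Complex.exp (θ * Complex.I) *
          hankelKernel α δ 0 t (ray θ R r) := by
        unfold hankelKernel
        refine continuous_const.mul (continuous_const.mul ?_)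
        exact (Complex.continuous_ofReal.neg).const_cpow (Or.inl hne)
      exact (this.tendsto 1).mono_left nhdsWithin_le_nhds
  have hG : Tendsto (fun δ => Real.pi * (t ^ (δ - 1) / Real.Gamma δ)) (𝓝[<] 1)
      (𝓝 (Real.pi * (t ^ ((1 : ℝ) - 1) / Real.Gamma 1))) := by
    have hc : ContinuousAt Real.Gamma 1 :=
      (Real.differentiableAt_Gamma fun m => by linarith [m.cast_nonneg (α := ℝ)]).continuousAt
    have h1 : ContinuousAt (fun δ : ℝ => t ^ (δ - 1)) 1 :=
      ContinuousAt.rpow continuousAt_const (by fun_prop) (Or.inl ht.ne')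
    exact ((continuousAt_const.mul (h1.div hc (by simp))).tendsto).mono_left nhdsWithin_le_nhds
  refine tendsto_nhds_unique ((Complex.continuous_im.tendsto _).comp hlim) (hG.congr' ?_)
  filter_upwards [self_mem_nhdsWithin] with δ hδ
  exact (hankelIntegral_im_of_lt h hδ ht hR).symm

/-! ### The Wright functions as contour integrals: decay, derivatives, total mass. -/

/-- `F_δ(s,t) = t ^ (δ - 1) W_{-α,δ}(-s / t ^ α)`, which has Laplace transform
`p ^ (-δ) exp (-s p ^ α)` in `t`. -/
noncomputable def wrightF (α δ s t : ℝ) : ℝ := t ^ (δ - 1) * wrightW (-α) δ (-s / t ^ α)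

theorem wrightG_eq_wrightF {α s t : ℝ} (ht : 0 < t) : wrightG α s t = wrightF α (1 - α) s t := by
  rw [wrightG, wrightF, one_div, ← Real.rpow_neg ht.le]; ring_nf

theorem wrightF_one (α δ s : ℝ) : wrightF α δ s 1 = wrightW (-α) δ (-s) := by
  simp [wrightF]

theorem cpow_mul_hankelKernel (α δ a s t : ℝ) {z : ℂ} (hz : z ≠ 0) :
    z ^ (a : ℂ) * hankelKernel α δ s t z = hankelKernel α (δ - a) s t z := by
  rw [hankelKernel, hankelKernel, mul_left_comm, ← Complex.cpow_add _ _ hz]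
  push_cast; ring_nf

theorem ray_ne_zero {α θ R r : ℝ} (h : IsHankelAngle α θ) (hR : 0 < R) (hr : 0 ≤ r) :
    ray θ R r ≠ 0 := Complex.slitPlane_ne_zero (ray_mem_slitPlane hR hr h.sin_pos)

/-- Expand `exp(-s z^α)` and integrate termwise. Each factor `z^α` lowers `δ` by `α`, and the series
of norms sums to `exp(|s| ‖z‖^α)` times the kernel at `s = 0`, which is integrable. -/
theorem hasSum_hankelIntegral {α θ : ℝ} (h : IsHankelAngle α θ) (δ s : ℝ) {t R : ℝ}
    (ht : 0 < t) (hR : 0 < R) :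
    HasSum (fun k : ℕ => (((-s) ^ k / k.factorial : ℝ) : ℂ) *
      hankelIntegral α θ R (δ - α * k) 0 t) (hankelIntegral α θ R δ s t) := by
  set ω := Complex.exp (θ * Complex.I) with hω
  obtain ⟨C, c, hC0, hc, hC⟩ := exists_exp_mul_norm_hankelKernel_ray_le h δ |s| (R₁ := R) ht hR
  have hsum : ∀ r, HasSum (fun k : ℕ =>
      (|s| * ‖ray θ R r‖ ^ α) ^ k / k.factorial * ‖hankelKernel α δ 0 t (ray θ R r)‖)
      (Real.exp (|s| * ‖ray θ R r‖ ^ α) * ‖hankelKernel α δ 0 t (ray θ R r)‖) := by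
    intro r
    refine HasSum.mul_right _ ?_
    rw [Real.exp_eq_exp_ℝ]
    exact NormedSpace.expSeries_div_hasSum_exp _
  have hterm : ∀ r, 0 < r → ∀ k : ℕ, ω * (((-s) ^ k / k.factorial : ℝ) : ℂ) *
      hankelKernel α (δ - α * k) 0 t (ray θ R r) = ω * (((-s * ray θ R r ^ (α : ℂ)) ^ k /
        k.factorial) * hankelKernel α δ 0 t (ray θ R r)) := by
    intro r hr k
    rw [← cpow_mul_hankelKernel _ _ _ _ _ (ray_ne_zero h hR hr.le), mul_pow, ← Complex.cpow_mul_nat]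
    push_cast
    ring
  have key := hasSum_integral_of_dominated_convergence (μ := volume.restrict (Ioi (0 : ℝ)))
    (F := fun (k : ℕ) r => ω * (((-s) ^ k / k.factorial : ℝ) : ℂ) *
      hankelKernel α (δ - α * k) 0 t (ray θ R r))
    (f := fun r => ω * hankelKernel α δ s t (ray θ R r))
    (fun k r => (|s| * ‖ray θ R r‖ ^ α) ^ k / k.factorial * ‖hankelKernel α δ 0 t (ray θ R r)‖)
    (fun k => ((measurable_hankelKernel_ray ..).const_mul _).aestronglyMeasurable) ?_
    (.of_forall fun r => (hsum r).summable) ?_ ?_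
  · refine (congrArg (fun f => HasSum f _) (funext fun k => ?_)).mp key
    rw [hankelIntegral, ← integral_const_mul]
    refine integral_congr_ae (.of_forall fun r => ?_)
    simp only [hω]
    ring
  · intro k
    filter_upwards [ae_restrict_mem measurableSet_Ioi] with r hr
    rw [hterm r hr k, norm_cexp_mul_I_mul, norm_mul, norm_div, norm_pow, norm_mul,
      Complex.norm_cpow_real]
    simp
  · simp_rw [(hsum _).tsum_eq]
    refine ((exp_neg_integrableOn_Ioi 0 hc).const_mul C).mono' ?_ ?_
    · have := (continuous_ray θ R).measurable
      exact (Measurable.mul (by fun_prop)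
        (measurable_hankelKernel_ray ..).norm).aestronglyMeasurable
    · filter_upwards [ae_restrict_mem measurableSet_Ioi] with r hr
      rw [Real.norm_of_nonneg (by positivity)]
      exact hC R r le_rfl le_rfl (le_of_lt hr)
  · filter_upwards [ae_restrict_mem measurableSet_Ioi] with r hr
    simp_rw [hterm r hr]
    refine HasSum.mul_left ω ?_
    have h1 : hankelKernel α δ s t (ray θ R r) = Complex.exp (-s * ray θ R r ^ (α : ℂ)) *
        hankelKernel α δ 0 t (ray θ R r) := by
      simp only [hankelKernel]
      rw [← mul_assoc, ← Complex.exp_add]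
      push_cast; ring_nf
    rw [h1]
    refine HasSum.mul_right _ ?_
    rw [Complex.exp_eq_exp_ℂ]
    exact NormedSpace.expSeries_div_hasSum_exp _

theorem hasSum_hankelIntegral_im {α θ : ℝ} (h : IsHankelAngle α θ)
    {δ : ℝ} (s : ℝ) {t R : ℝ} (hδ : δ ≤ 1) (ht : 0 < t) (hR : 0 < R) :
    HasSum (fun k : ℕ => Real.pi * t ^ (δ - 1) * ((-s / t ^ α) ^ k /
      ((k.factorial : ℝ) * Real.Gamma (-α * k + δ)))) (hankelIntegral α θ R δ s t).im := by
  have h2 := Complex.hasSum_im (hasSum_hankelIntegral h δ s ht hR)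
  refine (congrArg (fun f => HasSum f _) (funext fun k => ?_)).mp h2
  have h3 : δ - α * k ≤ 1 := by
    have := mul_nonneg h.pos.le (k.cast_nonneg (α := ℝ)); linarith
  rw [Complex.im_ofReal_mul, hankelIntegral_im h h3 ht hR, div_pow, ← Real.rpow_mul_natCast ht.le,
    show δ - α * k - 1 = (δ - 1) - α * k by ring, Real.rpow_sub ht,
    show -α * k + δ = δ - α * k by ring]
  ring

theorem summable_wrightW {α : ℝ} (h0 : 0 < α) (h1 : α < 1) {δ : ℝ} (hδ : δ ≤ 1) (z : ℝ) :
    Summable fun k : ℕ => z ^ k / ((k.factorial : ℝ) * Real.Gamma (-α * k + δ)) := by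
  obtain ⟨θ, h⟩ := exists_isHankelAngle h0 h1
  have := (hasSum_hankelIntegral_im h (-z) hδ one_pos one_pos).summable
  rw [summable_mul_left_iff (by simp [Real.pi_ne_zero])] at this
  simpa using this

theorem hankelIntegral_im_eq_wrightF {α θ : ℝ} (h : IsHankelAngle α θ) {δ : ℝ} (s : ℝ) {t R : ℝ}
    (hδ : δ ≤ 1) (ht : 0 < t) (hR : 0 < R) :
    (hankelIntegral α θ R δ s t).im = Real.pi * wrightF α δ s t := by
  rw [← (hasSum_hankelIntegral_im h s hδ ht hR).tsum_eq, tsum_mul_left, wrightF, wrightW, mul_assoc]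

theorem re_cpow_ray_ge {α θ R r : ℝ} (h : IsHankelAngle α θ) (hR : 0 < R) (hr : 0 ≤ r) :
    Real.cos (α * θ) * (R * Real.sin θ) ^ α ≤ (ray θ R r ^ (α : ℂ)).re := by
  refine le_trans ?_ (le_re_ray_cpow h hR hr)
  have := le_norm_ray_left θ R r
  have := h.sin_pos
  have := h.pos
  have := h.cos_mul_pos
  gcongr

/-- The source of decay faster than every exponential: with the tip far enough out, `exp(-s z^α)`
has norm at most `exp(-b s)` on the whole ray for `s ≥ 0`, while the imaginary part of the integral
is the same for every tip. -/
theorem exists_tip {α θ : ℝ} (h : IsHankelAngle α θ) (b : ℝ) :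
    ∃ R, 0 < R ∧ ∀ r, 0 ≤ r → b ≤ (ray θ R r ^ (α : ℂ)).re := by
  have h1 : Tendsto (fun R : ℝ => Real.cos (α * θ) * (R * Real.sin θ) ^ α) atTop atTop :=
    ((tendsto_rpow_atTop h.pos).comp
      (tendsto_id.atTop_mul_const h.sin_pos)).const_mul_atTop h.cos_mul_pos
  obtain ⟨R, hR, hb⟩ := ((eventually_gt_atTop 0).and (h1.eventually_ge_atTop b)).exists
  exact ⟨R, hR, fun r hr => hb.trans (re_cpow_ray_ge h hR hr)⟩

theorem exists_abs_wrightW_le {α : ℝ} (h0 : 0 < α) (h1 : α < 1) {δ : ℝ} (hδ : δ ≤ 1) (b : ℝ) :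
    ∃ C, 0 < C ∧ ∀ z, 0 ≤ z → |wrightW (-α) δ (-z)| ≤ C * Real.exp (-b * z) := by
  obtain ⟨θ, h⟩ := exists_isHankelAngle h0 h1
  obtain ⟨R, hR, hb⟩ := exists_tip h b
  set J := ∫ r in Ioi (0 : ℝ), ‖hankelKernel α δ 0 1 (ray θ R r)‖ with hJ
  have hJ0 : 0 ≤ J := integral_nonneg fun r => norm_nonneg _
  refine ⟨(J + 1) / Real.pi, by have := Real.pi_pos; positivity, fun z hz => ?_⟩
  have h2 := hankelIntegral_im_eq_wrightF h z hδ one_pos hR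
  rw [wrightF_one] at h2
  have h3 : ‖hankelIntegral α θ R δ z 1‖ ≤ Real.exp (-b * z) * J := by
    rw [hJ, ← integral_const_mul, hankelIntegral]
    refine norm_integral_le_of_norm_le
      ((integrableOn_hankelKernel_ray h δ 0 one_pos hR).norm.const_mul _) ?_
    filter_upwards [ae_restrict_mem measurableSet_Ioi] with r hr
    rw [norm_cexp_mul_I_mul, norm_hankelKernel_eq]
    refine mul_le_mul_of_nonneg_right (Real.exp_le_exp.2 ?_) (norm_nonneg _)
    nlinarith [hb r (le_of_lt hr)]
  have h4 : Real.pi * |wrightW (-α) δ (-z)| ≤ Real.exp (-b * z) * J := by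
    rw [← abs_of_pos Real.pi_pos, ← abs_mul, ← h2]
    exact (Complex.abs_im_le_norm _).trans h3
  rw [div_mul_eq_mul_div, le_div_iff₀ Real.pi_pos]
  nlinarith [Real.exp_pos (-b * z)]

/-- Differentiation under the contour integral brings down `-z^α`, which replaces `δ` by `δ - α`. -/
theorem hasDerivAt_wrightW_neg {α : ℝ} (h0 : 0 < α) (h1 : α < 1) {δ : ℝ} (hδ : δ ≤ 1) (s : ℝ) :
    HasDerivAt (fun s => wrightW (-α) δ (-s)) (-wrightW (-α) (δ - α) (-s)) s := by
  obtain ⟨θ, h⟩ := exists_isHankelAngle h0 h1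
  set ω := Complex.exp (θ * Complex.I) with hω
  obtain ⟨C, c, hC0, hc, hC⟩ := exists_norm_hankelKernel_ray_le h (δ - α) (|s| + 1)
    (R₁ := 1) one_pos one_pos
  have key := hasDerivAt_integral_of_dominated_loc_of_deriv_le
    (F := fun s r => ω * hankelKernel α δ s 1 (ray θ 1 r)) (x₀ := s)
    (F' := fun s r => -(ω * hankelKernel α (δ - α) s 1 (ray θ 1 r)))
    (μ := volume.restrict (Ioi 0)) (bound := fun r => C * Real.exp (-c * r))
    (Metric.ball_mem_nhds s one_pos)
    (.of_forall fun s => ((measurable_hankelKernel_ray ..).const_mul _).aestronglyMeasurable)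
    ((integrableOn_hankelKernel_ray h δ s one_pos one_pos).const_mul ω)
    ((measurable_hankelKernel_ray ..).const_mul _).neg.aestronglyMeasurable ?_
    ((exp_neg_integrableOn_Ioi 0 hc).const_mul C) ?_
  · have h2 := (Complex.imCLM.hasFDerivAt.comp_hasDerivAt s key.2)
    rw [integral_neg] at h2
    have h3 : ∀ {δ} (_ : δ ≤ 1) (s : ℝ), (∫ r in Ioi (0 : ℝ), ω * hankelKernel α δ s 1 (ray θ 1 r)).im
        = Real.pi * wrightW (-α) δ (-s) := by
      intro δ hδ s
      rw [← wrightF_one, ← hankelIntegral_im_eq_wrightF h s hδ one_pos one_pos, hankelIntegral]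
    have h4 := h2.const_mul Real.pi⁻¹
    have hπ := Real.pi_ne_zero
    refine (h4.congr_deriv ?_).congr_of_eventuallyEq (.of_forall fun x => ?_)
    · rw [map_neg, Complex.imCLM_apply, h3 (by linarith)]
      field_simp
    · simp only [Function.comp, Complex.imCLM_apply, h3 hδ]
      field_simp
  · filter_upwards [ae_restrict_mem measurableSet_Ioi] with r hr x hx
    rw [norm_neg, norm_cexp_mul_I_mul]
    refine hC 1 r x le_rfl le_rfl (le_of_lt hr) ?_
    rw [Metric.mem_ball, Real.dist_eq] at hx
    have := abs_add_le (x - s) s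
    rw [sub_add_cancel] at this
    linarith
  · filter_upwards [ae_restrict_mem measurableSet_Ioi] with r hr x hx
    rw [← cpow_mul_hankelKernel _ _ _ _ _ (ray_ne_zero h one_pos (le_of_lt hr)), ← mul_neg]
    refine HasDerivAt.const_mul ω ?_
    have h5 : HasDerivAt (fun x : ℝ => ((1 : ℝ) : ℂ) * ray θ 1 r - x * ray θ 1 r ^ (α : ℂ))
        (-(1 * ray θ 1 r ^ (α : ℂ))) x :=
      (((hasDerivAt_id x).ofReal_comp.mul_const _).const_sub _).congr_deriv (by simp)
    refine (h5.cexp.mul_const (ray θ 1 r ^ (-(δ : ℂ)))).congr_deriv ?_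
    simp only [hankelKernel]
    ring

theorem continuous_wrightW_neg {α : ℝ} (h0 : 0 < α) (h1 : α < 1) {δ : ℝ} (hδ : δ ≤ 1) :
    Continuous fun s => wrightW (-α) δ (-s) :=
  continuous_iff_continuousAt.2 fun s => (hasDerivAt_wrightW_neg h0 h1 hδ s).continuousAt

theorem integrableOn_wrightW_neg {α : ℝ} (h0 : 0 < α) (h1 : α < 1) {δ : ℝ} (hδ : δ ≤ 1) :
    IntegrableOn (fun z => wrightW (-α) δ (-z)) (Ioi 0) := by
  obtain ⟨C, -, hC⟩ := exists_abs_wrightW_le h0 h1 hδ 1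
  refine ((exp_neg_integrableOn_Ioi 0 one_pos).const_mul C).mono'
    (continuous_wrightW_neg h0 h1 hδ).aestronglyMeasurable ?_
  filter_upwards [ae_restrict_mem measurableSet_Ioi] with r hr
  exact hC r (le_of_lt hr)

theorem wrightW_zero (l d : ℝ) : wrightW l d 0 = 1 / Real.Gamma d := by
  rw [wrightW, tsum_eq_single 0 (fun k hk => by simp [hk])]
  simp

/-- The density has primitive `-W_{-α,1}(-z)`, which is `-1 / Γ(1) = -1` at `0` and tends to `0` at
infinity. Unit mass is what makes the transform continuous at `t = 0`. -/
theorem integral_wrightW_neg {α : ℝ} (h0 : 0 < α) (h1 : α < 1) :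
    ∫ z in Ioi (0 : ℝ), wrightW (-α) (1 - α) (-z) = 1 := by
  have hd := fun s => (hasDerivAt_wrightW_neg h0 h1 le_rfl s).neg
  simp only [neg_neg] at hd
  have htend : Tendsto (fun z => -wrightW (-α) 1 (-z)) atTop (𝓝 0) := by
    obtain ⟨C, -, hC⟩ := exists_abs_wrightW_le h0 h1 le_rfl 1
    have h2 : Tendsto (fun z : ℝ => C * Real.exp (-1 * z)) atTop (𝓝 0) := by
      have : Tendsto (fun z : ℝ => Real.exp (-1 * z)) atTop (𝓝 0) :=
        Real.tendsto_exp_atBot.comp (tendsto_id.const_mul_atTop_of_neg (by norm_num))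
      simpa using this.const_mul C
    refine squeeze_zero_norm' ?_ h2
    filter_upwards [eventually_ge_atTop 0] with z hz
    rw [norm_neg]
    exact hC z hz
  have := integral_Ioi_of_hasDerivAt_of_tendsto' (a := 0) (fun x _ => hd x)
    (integrableOn_wrightW_neg h0 h1 (by linarith)) htend
  rw [this]
  simp [wrightW_zero]

/-- The term `k = 0` vanishes since `1 / Γ(0) = 0`; after shifting the index, `Γ(x+1) = x Γ(x)` with
`x = -α(k+1)` matches the coefficients. This ties `F_0` to `g_α` and shows that `F_0` vanishes at `s
= 0`. -/
theorem wrightW_neg_zero {α : ℝ} (h0 : 0 < α) (h1 : α < 1) (z : ℝ) :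
    wrightW (-α) 0 (-z) = α * z * wrightW (-α) (1 - α) (-z) := by
  rw [wrightW, (summable_wrightW h0 h1 zero_le_one _).tsum_eq_zero_add, wrightW, ← tsum_mul_left]
  simp only [Nat.cast_zero, mul_zero, add_zero, Real.Gamma_zero, div_zero, zero_add]
  refine tsum_congr fun k => ?_
  have hk : -α * ((k + 1 : ℕ) : ℝ) ≠ 0 := mul_ne_zero (by linarith) (by positivity)
  have h2 := Real.Gamma_add_one hk
  have h3 : -α * k + (1 - α) = -α * ((k + 1 : ℕ) : ℝ) + 1 := by push_cast; ring
  rw [h3, h2]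
  -- At a pole of `Γ` both coefficients are `0` by convention.
  by_cases hG : Real.Gamma (-α * ((k + 1 : ℕ) : ℝ)) = 0
  · simp only [hG, mul_zero, div_zero]
  · rw [Nat.factorial_succ]
    have : (k.factorial : ℝ) ≠ 0 := by positivity
    push_cast at hG hk ⊢
    field_simp
    ring

theorem wrightF_zero_eq {α : ℝ} (h0 : 0 < α) (h1 : α < 1) (s t : ℝ) :
    wrightF α 0 s t = α * s / t * wrightG α s t := by
  rw [wrightF, wrightG, neg_div, wrightW_neg_zero h0 h1, zero_sub, Real.rpow_neg_one]
  ring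

/-! ### Fractional integrals of the kernels in `s` and in `t`. -/

theorem measurable_hankelKernel_uncurry {X : Type*} [MeasurableSpace X] (α δ θ R : ℝ)
    {f g h : X → ℝ} (hf : Measurable f) (hg : Measurable g) (hh : Measurable h) :
    Measurable fun x => hankelKernel α δ (f x) (g x) (ray θ R (h x)) := by
  unfold hankelKernel ray
  fun_prop

/-- Powers compose without a branch correction because `α arg z` stays in `[0, π/2)` on the ray. -/
theorem mul_cpow_ray {α θ R r : ℝ} (h : IsHankelAngle α θ) (hR : 0 < R) (hr : 0 ≤ r) (p : ℝ) :
    (ray θ R r ^ (α : ℂ)) ^ (p : ℂ) = ray θ R r ^ ((α * p : ℝ) : ℂ) := by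
  have h1 := arg_ray_nonneg (R := R) hr h.sin_pos.le
  have h2 := arg_ray_le h hR hr
  have h3 : α * (ray θ R r).arg ≤ α * θ := mul_le_mul_of_nonneg_left h2 h.pos.le
  have h4 : 0 ≤ α * (ray θ R r).arg := mul_nonneg h.pos.le h1
  have him : (Complex.log (ray θ R r) * α).im = α * (ray θ R r).arg := by
    rw [mul_comm, Complex.im_ofReal_mul, Complex.log_im]
  rw [Complex.ofReal_mul, Complex.cpow_mul _ _]
  · rw [him]; linarith [Real.pi_pos, h.mul_lt, h3]
  · rw [him]; linarith [Real.pi_pos, h.mul_lt, h3]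

/-- The Weyl integral in `s` of order `1 - β` of `g_α`. -/
theorem integral_rpow_mul_wrightG {α β s t : ℝ} (h0 : 0 < α) (h1 : α < 1) (hβ0 : 0 < β)
    (hβ1 : β < 1) (ht : 0 < t) :
    ∫ v in Ioi (0 : ℝ), v ^ (-β) * wrightG α (s + v) t =
      Real.Gamma (1 - β) * wrightF α (1 - β * α) s t := by
  obtain ⟨θ, h⟩ := exists_isHankelAngle h0 h1
  -- With `Re z^α ≥ 1` on the ray, the factor `exp(-v z^α)` makes the double integral in `v` and `r`
  -- absolutely convergent.
  obtain ⟨R, hR, hb⟩ := exists_tip h 1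
  set ω := Complex.exp (θ * Complex.I) with hω
  let f : ℝ → ℝ → ℂ := fun v r =>
    ((v ^ (-β) : ℝ) : ℂ) * (ω * hankelKernel α (1 - α) (s + v) t (ray θ R r))
  have hK : ∀ v r, hankelKernel α (1 - α) (s + v) t (ray θ R r) =
      Complex.exp (-(v * ray θ R r ^ (α : ℂ))) * hankelKernel α (1 - α) s t (ray θ R r) := by
    intro v r
    simp only [hankelKernel]
    rw [← mul_assoc, ← Complex.exp_add]
    push_cast; ring_nf
  have hint : Integrable (Function.uncurry f)
      ((volume.restrict (Ioi 0)).prod (volume.restrict (Ioi 0))) := by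
    have hv : IntegrableOn (fun v : ℝ => v ^ (-β) * Real.exp (-1 * v)) (Ioi 0) := by
      have := integrableOn_rpow_mul_exp_neg_mul_rpow (s := -β) (by linarith) one_pos one_pos
      simpa only [Real.rpow_one] using this
    refine (hv.mul_prod (integrableOn_hankelKernel_ray h (1 - α) s ht hR).norm).mono' ?_ ?_
    · refine Measurable.aestronglyMeasurable ?_
      refine Measurable.mul (by fun_prop) (Measurable.const_mul ?_ _)
      exact measurable_hankelKernel_uncurry _ _ _ _ (by fun_prop) measurable_const measurable_snd
    · rw [Measure.prod_restrict]
      filter_upwards [ae_restrict_mem (measurableSet_Ioi.prod measurableSet_Ioi)] with p hp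
      obtain ⟨hv, hr⟩ := hp
      rw [mem_Ioi] at hv hr
      simp only [Function.uncurry, f]
      rw [norm_mul, norm_cexp_mul_I_mul, hK, norm_mul, Complex.norm_exp, Complex.norm_real,
        Real.norm_of_nonneg (by positivity), ← mul_assoc]
      gcongr
      rw [Complex.neg_re, Complex.re_ofReal_mul]
      nlinarith [hb p.2 hr.le]
  have hswap := integral_integral_swap hint
  have hL : ∀ v, (∫ r in Ioi (0 : ℝ), f v r).im = Real.pi * (v ^ (-β) * wrightG α (s + v) t) := by
    intro v
    simp only [f]
    rw [integral_const_mul, Complex.im_ofReal_mul, wrightG_eq_wrightF ht, mul_left_comm,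
      ← hankelIntegral_im_eq_wrightF h _ (by linarith) ht hR, hankelIntegral]
  have hRr : ∫ r in Ioi (0 : ℝ), ∫ v in Ioi (0 : ℝ), f v r =
      Real.Gamma (1 - β) * hankelIntegral α θ R (1 - β * α) s t := by
    rw [hankelIntegral, ← integral_const_mul]
    refine setIntegral_congr_fun measurableSet_Ioi fun r hr => ?_
    rw [mem_Ioi] at hr
    have hz : 0 < (ray θ R r ^ (α : ℂ)).re := one_pos.trans_le (hb r hr.le)
    have hG := integral_rpow_mul_cexp_neg_mul (a := 1 - β) (by linarith) hz
    have hf : ∀ v, f v r = (((v ^ (1 - β - 1) : ℝ) : ℂ) *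
        Complex.exp (-(v * ray θ R r ^ (α : ℂ)))) *
          (ω * hankelKernel α (1 - α) s t (ray θ R r)) := by
      intro v
      simp only [f]
      rw [hK, show 1 - β - 1 = -β by ring]
      ring
    simp_rw [hf]
    -- The `v`-integral contributes `z^(-α(1-β))`, which combines with `z^(-(1-α))` to
    -- `z^(-(1-βα))`.
    rw [integral_mul_const, hG, ← Complex.ofReal_neg, mul_cpow_ray h hR hr.le, mul_assoc,
      mul_left_comm _ ω, cpow_mul_hankelKernel _ _ _ _ _ (ray_ne_zero h hR hr.le), hω]
    ring_nf
  have h5 := Complex.imCLM.integral_comp_comm hint.integral_prod_left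
  simp only [Function.uncurry_apply_pair, Complex.imCLM_apply] at h5
  rw [hswap, hRr, Complex.im_ofReal_mul, hankelIntegral_im_eq_wrightF h _ (by nlinarith) ht hR] at h5
  simp_rw [hL] at h5
  rw [integral_const_mul] at h5
  have := Real.pi_pos
  refine mul_left_cancel₀ this.ne' ?_
  rw [h5]; ring

theorem intervalIntegrable_sub_rpow {γ : ℝ} (hγ : 0 < γ) (t : ℝ) :
    IntervalIntegrable (fun τ : ℝ => (t - τ) ^ (γ - 1)) volume 0 t := by
  have := (intervalIntegral.intervalIntegrable_rpow' (a := t) (b := 0) (r := γ - 1)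
    (by linarith)).comp_sub_left t
  simpa using this

/-- `J^γ` of an exponential differs from `exp (t z) z ^ (-γ)` by a bounded function. -/
theorem exists_norm_fracIntegral_exp_sub_le {γ t : ℝ} (hγ0 : 0 < γ) (hγ1 : γ < 1) (ht : 0 < t) :
    ∃ C, 0 ≤ C ∧ ∀ z : ℂ, 1 ≤ ‖z‖ →
      ‖(∫ τ in Ioc (0 : ℝ) t, (((t - τ) ^ (γ - 1) : ℝ) : ℂ) * Complex.exp (τ * z)) -
        Real.Gamma γ * (Complex.exp (t * z) * z ^ (-(γ : ℂ)))‖ ≤ C := by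
  have hI : IntegrableOn (fun τ : ℝ => (t - τ) ^ (γ - 1)) (Ioc 0 t) :=
    (intervalIntegrable_iff_integrableOn_Ioc_of_le ht.le).1 (intervalIntegrable_sub_rpow hγ0 t)
  set J := ∫ τ in Ioc (0 : ℝ) t, (t - τ) ^ (γ - 1) with hJ
  have hJ0 : 0 ≤ J := setIntegral_nonneg measurableSet_Ioc fun τ hτ => by
    have : 0 ≤ t - τ := by linarith [hτ.2]
    positivity
  have hG := Real.Gamma_pos_of_pos hγ0
  refine ⟨max (t ^ (γ - 1)) (J * Real.exp t + Real.Gamma γ * Real.exp t), by positivity,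
    fun z hz => ?_⟩
  -- If `Re z ≥ 1`, the difference is `-exp(tz)` times the tail of the Gamma integral over `(t,∞)`,
  -- of norm at most `t^(γ-1) ∫_t^∞ exp(t-v) dv = t^(γ-1)`. If `Re z ≤ 1`, the two terms are bounded
  -- separately, the second by means of `‖z‖ ≥ 1`.
  rcases le_total 1 z.re with hre | hre
  · refine le_trans ?_ (le_max_left _ _)
    have hre0 : 0 < z.re := one_pos.trans_le hre
    have h1 := integral_rpow_mul_cexp_neg_mul hγ0 hre0
    have hnorm : ∀ v : ℝ, 0 < v → ‖((v ^ (γ - 1) : ℝ) : ℂ) * Complex.exp (-(v * z))‖ =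
        v ^ (γ - 1) * Real.exp (-z.re * v) := by
      intro v hv
      rw [norm_mul, Complex.norm_real, Complex.norm_exp, Real.norm_of_nonneg (by positivity)]
      simp [mul_comm]
    have hint : IntegrableOn (fun v : ℝ => ((v ^ (γ - 1) : ℝ) : ℂ) * Complex.exp (-(v * z)))
        (Ioi 0) := by
      have := integrableOn_rpow_mul_exp_neg_mul_rpow (s := γ - 1) (by linarith) one_pos hre0
      simp only [Real.rpow_one] at this
      refine this.mono' (Measurable.aestronglyMeasurable (by fun_prop)) ?_
      filter_upwards [ae_restrict_mem measurableSet_Ioi] with v hv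
      exact (hnorm v hv).le
    have h2 : ∫ τ in Ioc (0 : ℝ) t, (((t - τ) ^ (γ - 1) : ℝ) : ℂ) * Complex.exp (τ * z) =
        Complex.exp (t * z) *
          ∫ v in Ioc (0 : ℝ) t, ((v ^ (γ - 1) : ℝ) : ℂ) * Complex.exp (-(v * z)) := by
      rw [← integral_const_mul, ← intervalIntegral.integral_of_le ht.le,
        ← intervalIntegral.integral_of_le ht.le]
      have := intervalIntegral.integral_comp_sub_left (a := 0) (b := t)
        (fun v : ℝ => Complex.exp (t * z) * (((v ^ (γ - 1) : ℝ) : ℂ) * Complex.exp (-(v * z)))) t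
      rw [sub_self, sub_zero] at this
      rw [← this]
      refine intervalIntegral.integral_congr fun τ _ => ?_
      rw [mul_left_comm, ← Complex.exp_add]
      push_cast; ring_nf
    have h3 := setIntegral_union (Ioc_disjoint_Ioi (a := (0 : ℝ)) (le_refl t)) measurableSet_Ioi
      (hint.mono_set Ioc_subset_Ioi_self) (hint.mono_set (Ioi_subset_Ioi ht.le))
    rw [Ioc_union_Ioi_eq_Ioi ht.le, h1] at h3
    rw [h2, mul_left_comm, h3, mul_add, sub_add_cancel_left, norm_neg, ← integral_const_mul]
    have h4 : IntegrableOn (fun v => t ^ (γ - 1) * Real.exp t * Real.exp (-1 * v)) (Ioi t) :=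
      (exp_neg_integrableOn_Ioi t one_pos).const_mul _
    refine (norm_integral_le_of_norm_le h4 ?_).trans (le_of_eq ?_)
    · filter_upwards [ae_restrict_mem measurableSet_Ioi] with v hv
      rw [mem_Ioi] at hv
      rw [norm_mul, hnorm v (ht.trans hv), Complex.norm_exp, Complex.re_ofReal_mul, mul_left_comm,
        mul_assoc, ← Real.exp_add, ← Real.exp_add]
      refine mul_le_mul (Real.rpow_le_rpow_of_nonpos ht hv.le (by linarith))
        (Real.exp_le_exp.2 (by nlinarith)) (Real.exp_pos _).le (by positivity)
    · rw [integral_const_mul]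
      have := integral_exp_neg_Ioi t
      simp only [neg_mul, one_mul]
      rw [this, mul_assoc, ← Real.exp_add, add_neg_cancel, Real.exp_zero, mul_one]
  · refine le_trans ?_ (le_max_right _ _)
    refine (norm_sub_le _ _).trans (add_le_add ?_ ?_)
    · rw [hJ, ← integral_mul_const]
      refine norm_integral_le_of_norm_le (hI.mul_const _) ?_
      filter_upwards [ae_restrict_mem measurableSet_Ioc] with τ hτ
      have h0 : 0 ≤ t - τ := by linarith [hτ.2]
      rw [norm_mul, Complex.norm_real, Real.norm_of_nonneg (by positivity), Complex.norm_exp,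
        Complex.re_ofReal_mul]
      refine mul_le_mul_of_nonneg_left (Real.exp_le_exp.2 ?_) (by positivity)
      nlinarith [hτ.1, hτ.2]
    · rw [norm_mul, norm_mul, Complex.norm_exp, Complex.re_ofReal_mul, Complex.norm_real,
        Real.norm_of_nonneg hG.le, ← Complex.ofReal_neg, Complex.norm_cpow_real]
      have h1 : ‖z‖ ^ (-γ) ≤ 1 := Real.rpow_le_one_of_one_le_of_nonpos hz (by linarith)
      have h2 : Real.exp (t * z.re) ≤ Real.exp t := Real.exp_le_exp.2 (by nlinarith)
      have h3 : Real.exp (t * z.re) * ‖z‖ ^ (-γ) ≤ Real.exp t * 1 :=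
        mul_le_mul h2 h1 (by positivity) (Real.exp_pos _).le
      rw [mul_one] at h3
      gcongr

/-- The fractional integral in `t` of order `γ` of the stable density `F_0(s,·)`. -/
theorem integral_sub_rpow_mul_wrightF_zero {α γ s t : ℝ} (h0 : 0 < α) (h1 : α < 1) (hγ0 : 0 < γ)
    (hγ1 : γ < 1) (hs : 0 < s) (ht : 0 < t) :
    ∫ τ in Ioc (0 : ℝ) t, (t - τ) ^ (γ - 1) * wrightF α 0 s τ =
      Real.Gamma γ * wrightF α γ s t := by
  obtain ⟨θ, h⟩ := exists_isHankelAngle h0 h1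
  have hm := h.sin_pos
  have hη := h.cos_mul_pos
  set ω := Complex.exp (θ * Complex.I) with hω
  obtain ⟨C, hC0, hC⟩ := exists_norm_fracIntegral_exp_sub_le hγ0 hγ1 ht
  have hI : IntegrableOn (fun τ : ℝ => (t - τ) ^ (γ - 1)) (Ioc 0 t) :=
    (intervalIntegrable_iff_integrableOn_Ioc_of_le ht.le).1 (intervalIntegrable_sub_rpow hγ0 t)
  -- Half of the available rate provides smallness in `R`, the other half integrability in `r`. The
  -- latter cannot come from `exp(τ z)`, whose decay is lost as `τ → 0`; this is where `s > 0`
  -- enters.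
  set B := s * Real.cos (α * θ) * Real.sin θ ^ α / 2 with hB
  have hB0 : 0 < B := by positivity
  -- decay of the space factor, uniformly along the contour
  have hdecay : ∀ R r : ℝ, 0 < R → 0 < r →
      B * R ^ α + B * r ^ α ≤ s * (ray θ R r ^ (α : ℂ)).re := by
    intro R r hR hr
    have e1 : (R * Real.sin θ) ^ α ≤ ‖ray θ R r‖ ^ α :=
      Real.rpow_le_rpow (by positivity) (le_norm_ray_left θ R r) h0.le
    have e2 : (r * Real.sin θ) ^ α ≤ ‖ray θ R r‖ ^ α :=
      Real.rpow_le_rpow (by positivity) (le_norm_ray_right θ R r) h0.le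
    rw [Real.mul_rpow hR.le hm.le] at e1
    rw [Real.mul_rpow hr.le hm.le] at e2
    have e3 := mul_le_mul_of_nonneg_left (le_re_ray_cpow h hR hr.le) hs.le
    have e4 := mul_le_mul_of_nonneg_left (add_le_add e1 e2) (mul_pos hs hη).le
    rw [hB]
    linarith
  have hexp : IntegrableOn (fun r : ℝ => Real.exp (-B * r ^ α)) (Ioi 0) := by
    have := integrableOn_rpow_mul_exp_neg_mul_rpow (s := 0) (by norm_num) h0 hB0
    simpa only [Real.rpow_zero, one_mul] using this
  set J := ∫ r in Ioi (0 : ℝ), Real.exp (-B * r ^ α) with hJ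
  -- The defect `D` does not depend on the tip `R`. On the contour it is the integral of `exp(-s
  -- z^α)` against a function bounded by `C`, hence of size `exp(-B R^α)`, and `R → ∞` forces `D =
  -- 0`.
  let D := (∫ τ in Ioc (0 : ℝ) t, (t - τ) ^ (γ - 1) * wrightF α 0 s τ) -
      Real.Gamma γ * wrightF α γ s t
  have hbound : ∀ R, 0 < R → 1 ≤ R * Real.sin θ →
      Real.pi * |D| ≤ C * Real.exp (-(B * R ^ α)) * J := by
    intro R hR hR1
    let f : ℝ → ℝ → ℂ := fun τ r =>
      (((t - τ) ^ (γ - 1) : ℝ) : ℂ) * (ω * hankelKernel α 0 s τ (ray θ R r))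
    have hK : ∀ τ r, hankelKernel α 0 s τ (ray θ R r) =
        Complex.exp (-(s * ray θ R r ^ (α : ℂ))) * Complex.exp (τ * ray θ R r) := by
      intro τ r
      simp only [hankelKernel]
      rw [← Complex.exp_add, Complex.ofReal_zero, neg_zero, Complex.cpow_zero, mul_one]
      ring_nf
    have hint : Integrable (Function.uncurry f)
        ((volume.restrict (Ioc 0 t)).prod (volume.restrict (Ioi 0))) := by
      refine ((hI.mul_const (Real.exp (t * R))).mul_prod hexp).mono' ?_ ?_
      · refine Measurable.aestronglyMeasurable ?_
        refine Measurable.mul (by fun_prop) (Measurable.const_mul ?_ _)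
        exact measurable_hankelKernel_uncurry _ _ _ _ measurable_const measurable_fst
          measurable_snd
      · rw [Measure.prod_restrict]
        filter_upwards [ae_restrict_mem (measurableSet_Ioc.prod measurableSet_Ioi)] with p hp
        obtain ⟨hτ, hr⟩ := hp
        rw [mem_Ioi] at hr
        have h2 : 0 ≤ t - p.1 := by linarith [hτ.2]
        simp only [Function.uncurry, f]
        rw [norm_mul, norm_cexp_mul_I_mul, hK, norm_mul, Complex.norm_exp, Complex.norm_exp,
          Complex.norm_real, Real.norm_of_nonneg (by positivity), mul_assoc,
          mul_comm (Real.exp _) (Real.exp (_ : ℂ).re), Complex.re_ofReal_mul, Complex.neg_re,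
          Complex.re_ofReal_mul]
        have h3 : (ray θ R p.2).re ≤ R := by
          rw [ray_re]; nlinarith [h.cos_neg]
        have h4 := hdecay R p.2 hR hr
        have h5 : 0 < B * R ^ α := by positivity
        have h6 : p.1 * (ray θ R p.2).re ≤ t * R :=
          (mul_le_mul_of_nonneg_left h3 hτ.1.le).trans (mul_le_mul_of_nonneg_right hτ.2 hR.le)
        refine mul_le_mul_of_nonneg_left (mul_le_mul (Real.exp_le_exp.2 h6)
          (Real.exp_le_exp.2 ?_) (Real.exp_pos _).le (Real.exp_pos _).le) (by positivity)
        linarith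
    have hswap := integral_integral_swap hint
    have hL : ∀ τ ∈ Ioc (0 : ℝ) t, (∫ r in Ioi (0 : ℝ), f τ r).im =
        Real.pi * ((t - τ) ^ (γ - 1) * wrightF α 0 s τ) := by
      intro τ hτ
      simp only [f]
      rw [integral_const_mul, Complex.im_ofReal_mul, mul_left_comm,
        ← hankelIntegral_im_eq_wrightF h _ zero_le_one hτ.1 hR, hankelIntegral]
    have h5 := Complex.imCLM.integral_comp_comm hint.integral_prod_left
    simp only [Function.uncurry_apply_pair, Complex.imCLM_apply] at h5
    rw [setIntegral_congr_fun measurableSet_Ioc hL, integral_const_mul, hswap] at h5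
    have h6 : Real.pi * D = (∫ r in Ioi (0 : ℝ), ((∫ τ in Ioc (0 : ℝ) t, f τ r) -
        Real.Gamma γ * (ω * hankelKernel α γ s t (ray θ R r)))).im := by
      have e0 : Integrable (fun r => ∫ τ in Ioc (0 : ℝ) t, f τ r) (volume.restrict (Ioi 0)) :=
        hint.integral_prod_right
      rw [integral_sub e0
        (((integrableOn_hankelKernel_ray h γ s ht hR).const_mul _).const_mul _),
        Complex.sub_im, ← h5, integral_const_mul, Complex.im_ofReal_mul]
      have := hankelIntegral_im_eq_wrightF h s hγ1.le ht hR
      rw [hankelIntegral] at this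
      rw [this]
      simp only [D]
      ring
    rw [← abs_of_pos Real.pi_pos, ← abs_mul, h6]
    refine (Complex.abs_im_le_norm _).trans ?_
    rw [hJ, ← integral_const_mul]
    refine norm_integral_le_of_norm_le (hexp.const_mul _) ?_
    filter_upwards [ae_restrict_mem measurableSet_Ioi] with r hr
    rw [mem_Ioi] at hr
    have h7 : (∫ τ in Ioc (0 : ℝ) t, f τ r) -
        Real.Gamma γ * (ω * hankelKernel α γ s t (ray θ R r)) =
        ω * (Complex.exp (-(s * ray θ R r ^ (α : ℂ))) *
        ((∫ τ in Ioc (0 : ℝ) t, (((t - τ) ^ (γ - 1) : ℝ) : ℂ) * Complex.exp (τ * ray θ R r)) -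
        Real.Gamma γ * (Complex.exp (t * ray θ R r) * ray θ R r ^ (-(γ : ℂ))))) := by
      have e1 : ∀ τ, f τ r = ω * Complex.exp (-(s * ray θ R r ^ (α : ℂ))) *
          ((((t - τ) ^ (γ - 1) : ℝ) : ℂ) * Complex.exp (τ * ray θ R r)) := by
        intro τ
        simp only [f, hK]
        ring
      have e2 : hankelKernel α γ s t (ray θ R r) = Complex.exp (-(s * ray θ R r ^ (α : ℂ))) *
          (Complex.exp (t * ray θ R r) * ray θ R r ^ (-(γ : ℂ))) := by
        simp only [hankelKernel]
        rw [← mul_assoc, ← Complex.exp_add]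
        ring_nf
      simp_rw [e1]
      rw [integral_const_mul, e2]
      ring
    rw [h7, norm_cexp_mul_I_mul, norm_mul, Complex.norm_exp, Complex.neg_re,
      Complex.re_ofReal_mul, mul_comm, mul_assoc, ← Real.exp_add]
    have h8 := hC (ray θ R r) (hR1.trans (le_norm_ray_left θ R r))
    have h9 := hdecay R r hR hr
    gcongr
    linarith
  have hlim : Tendsto (fun R : ℝ => C * Real.exp (-(B * R ^ α)) * J) atTop (𝓝 0) := by
    have h2 : Tendsto (fun R : ℝ => Real.exp (-(B * R ^ α))) atTop (𝓝 0) :=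
      Real.tendsto_exp_neg_atTop_nhds_zero.comp ((tendsto_rpow_atTop h0).const_mul_atTop hB0)
    simpa using (h2.const_mul C).mul_const J
  have hD : Real.pi * |D| ≤ 0 := by
    refine ge_of_tendsto hlim ?_
    filter_upwards [eventually_gt_atTop 0, eventually_ge_atTop (1 / Real.sin θ)] with R hR hR1
    exact hbound R hR (by rwa [div_le_iff₀ hm] at hR1)
  have hD0 : |D| = 0 := le_antisymm (by nlinarith [Real.pi_pos]) (abs_nonneg _)
  exact sub_eq_zero.1 (abs_eq_zero.1 hD0)

/-! ### Derivatives and bounds of `F_δ(s,t)` in both variables. -/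

theorem measurable_wrightF {α : ℝ} (h0 : 0 < α) (h1 : α < 1) {δ : ℝ} (hδ : δ ≤ 1) :
    Measurable fun p : ℝ × ℝ => wrightF α δ p.1 p.2 := by
  have h := (continuous_wrightW_neg h0 h1 hδ).measurable
  have h2 : Measurable fun p : ℝ × ℝ => p.1 / p.2 ^ α := by fun_prop
  have h3 := h.comp h2
  have h4 : Measurable fun p : ℝ × ℝ => p.2 ^ (δ - 1) := by fun_prop
  simp only [wrightF, neg_div]
  exact h4.mul h3

theorem hasDerivAt_wrightF_space {α : ℝ} (h0 : 0 < α) (h1 : α < 1) {δ : ℝ} (hδ : δ ≤ 1) (s : ℝ)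
    {t : ℝ} (ht : 0 < t) :
    HasDerivAt (fun s => wrightF α δ s t) (-wrightF α (δ - α) s t) s := by
  have h2 := (hasDerivAt_wrightW_neg h0 h1 hδ (s / t ^ α)).comp s
    ((hasDerivAt_id s).div_const (t ^ α))
  have h3 := h2.const_mul (t ^ (δ - 1))
  simp only [wrightF, neg_div]
  refine h3.congr_deriv ?_
  rw [show δ - α - 1 = (δ - 1) - α by ring, Real.rpow_sub ht (δ - 1) α]
  simp only [div_eq_mul_inv]
  ring

theorem continuous_wrightF {α : ℝ} (h0 : 0 < α) (h1 : α < 1) {δ : ℝ} (hδ : δ ≤ 1) {t : ℝ}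
    (ht : 0 < t) : Continuous fun s => wrightF α δ s t :=
  continuous_iff_continuousAt.2 fun s => (hasDerivAt_wrightF_space h0 h1 hδ s ht).continuousAt

/-- Compare two derivatives of `W_{-α,0}(-z)`: the general rule, and the product rule applied to
`wrightW_neg_zero`. -/
theorem wrightW_neg_alpha {α : ℝ} (h0 : 0 < α) (h1 : α < 1) (z : ℝ) :
    wrightW (-α) (-α) (-z) = -(α * wrightW (-α) (1 - α) (-z)) +
      α * z * wrightW (-α) (1 - α - α) (-z) := by
  have h2 := hasDerivAt_wrightW_neg h0 h1 zero_le_one z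
  have h3 := ((hasDerivAt_id z).const_mul α).mul
    (hasDerivAt_wrightW_neg h0 h1 (by linarith : 1 - α ≤ 1) z)
  have h4 : (fun s => wrightW (-α) 0 (-s)) = (fun y => α * id y) *
      fun s => wrightW (-α) (1 - α) (-s) := funext fun s => wrightW_neg_zero h0 h1 s
  rw [h4] at h2
  have h5 := h2.unique h3
  simp only [id, zero_sub] at h5
  linarith

/-- In the Laplace variable this is multiplication by `z`, taking `δ = 1 - α` to `-α`. The proof
uses the chain rule; `wrightW_neg_alpha` collects the two resulting terms. -/
theorem hasDerivAt_wrightG_time {α : ℝ} (h0 : 0 < α) (h1 : α < 1) (s : ℝ) {t : ℝ} (ht : 0 < t) :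
    HasDerivAt (fun t => wrightG α s t) (wrightF α (-α) s t) t := by
  have hp : HasDerivAt (fun t : ℝ => t ^ (-α)) (-α * t ^ (-α - 1)) t :=
    Real.hasDerivAt_rpow_const (Or.inl ht.ne')
  have hz : HasDerivAt (fun t : ℝ => s * t ^ (-α)) (s * (-α * t ^ (-α - 1))) t := hp.const_mul s
  have h2 := hp.mul ((hasDerivAt_wrightW_neg h0 h1 (by linarith : 1 - α ≤ 1) (s * t ^ (-α))).comp
    t hz)
  have heq : (fun t => wrightG α s t) =ᶠ[𝓝 t] ((fun t : ℝ => t ^ (-α)) *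
      ((fun s => wrightW (-α) (1 - α) (-s)) ∘ fun t : ℝ => s * t ^ (-α))) := by
    filter_upwards [lt_mem_nhds ht] with x hx
    simp only [wrightG, Pi.mul_apply, Function.comp, Real.rpow_neg hx.le]
    rw [one_div, neg_div, div_eq_mul_inv]
  refine (h2.congr_deriv ?_).congr_of_eventuallyEq heq
  rw [wrightF, neg_div, div_eq_mul_inv, ← Real.rpow_neg ht.le, wrightW_neg_alpha h0 h1]
  rw [Real.rpow_sub_one ht.ne', Function.comp]
  ring

theorem exists_abs_wrightF_le {α : ℝ} (h0 : 0 < α) (h1 : α < 1) {δ : ℝ} (hδ : δ ≤ 1) (b : ℝ)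
    {T₀ T : ℝ} (hT₀ : 0 < T₀) :
    ∃ C, 0 < C ∧ ∀ t s, T₀ ≤ t → t ≤ T → 0 ≤ s → |wrightF α δ s t| ≤ C * Real.exp (-b * s) := by
  -- For `t ≤ T` one has `s ≤ T^α (s / t^α)`, so this rate in the scaled variable gives rate `b` in
  -- `s`.
  obtain ⟨C, hC0, hC⟩ := exists_abs_wrightW_le h0 h1 hδ (|b| * T ^ α)
  refine ⟨T₀ ^ (δ - 1) * C, by positivity, fun t s ht hT hs => ?_⟩
  have ht0 := hT₀.trans_le ht
  rw [wrightF, abs_mul, abs_of_pos (Real.rpow_pos_of_pos ht0 _), neg_div, mul_assoc]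
  refine mul_le_mul (Real.rpow_le_rpow_of_nonpos hT₀ ht (by linarith))
    ((hC _ (by positivity)).trans ?_) (abs_nonneg _) (by positivity)
  refine mul_le_mul_of_nonneg_left (Real.exp_le_exp.2 ?_) hC0.le
  have h2 : t ^ α ≤ T ^ α := Real.rpow_le_rpow ht0.le hT h0.le
  have h3 : s ≤ T ^ α * (s / t ^ α) := by
    rw [mul_div_assoc', le_div_iff₀ (by positivity)]; nlinarith
  have h4 := mul_le_mul_of_nonneg_left h3 (abs_nonneg b)
  nlinarith [le_abs_self b]

/-! ### Integration of Laplace integrable functions against the kernels. -/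

/-- The Laplace integral of `φ` converges absolutely somewhere. -/
def LaplaceIntegrable (φ : ℝ → ℝ) : Prop :=
  ∃ a : ℝ, IntegrableOn (fun s => Real.exp (-a * s) * φ s) (Ioi 0)

theorem LaplaceIntegrable.aestronglyMeasurable {φ : ℝ → ℝ} (h : LaplaceIntegrable φ) :
    AEStronglyMeasurable φ (volume.restrict (Ioi 0)) := by
  obtain ⟨a, ha⟩ := h
  have h2 : AEStronglyMeasurable (fun s : ℝ => Real.exp (a * s)) (volume.restrict (Ioi 0)) :=
    (by fun_prop : Continuous fun s : ℝ => Real.exp (a * s)).aestronglyMeasurable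
  refine (h2.mul ha.aestronglyMeasurable).congr (.of_forall fun s => ?_)
  simp only [Pi.mul_apply]
  rw [← mul_assoc, ← Real.exp_add, neg_mul, add_neg_cancel, Real.exp_zero, one_mul]

/-- `φ` is integrable against `exp (-b s)` for all large `b`. -/
theorem LaplaceIntegrable.eventually {φ : ℝ → ℝ} (h : LaplaceIntegrable φ) :
    ∃ b, 0 < b ∧ IntegrableOn (fun s => Real.exp (-b * s) * φ s) (Ioi 0) := by
  obtain ⟨a, ha⟩ := id h
  refine ⟨max a 1, by positivity, ?_⟩
  refine Integrable.mono ha ?_ ?_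
  · exact (by fun_prop : Continuous fun s : ℝ =>
      Real.exp (-(max a 1) * s)).aestronglyMeasurable.mul h.aestronglyMeasurable
  · filter_upwards [ae_restrict_mem measurableSet_Ioi] with s hs
    rw [mem_Ioi] at hs
    rw [norm_mul, norm_mul, Real.norm_of_nonneg (Real.exp_pos _).le,
      Real.norm_of_nonneg (Real.exp_pos _).le]
    refine mul_le_mul_of_nonneg_right (Real.exp_le_exp.2 ?_) (norm_nonneg _)
    nlinarith [le_max_left a 1]

theorem LaplaceIntegrable.of_abs_le {φ : ℝ → ℝ} {C b : ℝ}
    (hm : AEStronglyMeasurable φ (volume.restrict (Ioi 0)))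
    (h : ∀ s, 0 < s → |φ s| ≤ C * Real.exp (b * s)) : LaplaceIntegrable φ := by
  refine ⟨b + 1, ((exp_neg_integrableOn_Ioi 0 one_pos).const_mul C).mono' ?_ ?_⟩
  · exact (by fun_prop : Continuous fun s : ℝ =>
      Real.exp (-(b + 1) * s)).aestronglyMeasurable.mul hm
  · filter_upwards [ae_restrict_mem measurableSet_Ioi] with s hs
    rw [norm_mul, Real.norm_of_nonneg (Real.exp_pos _).le]
    calc _ ≤ Real.exp (-(b + 1) * s) * (C * Real.exp (b * s)) :=
          mul_le_mul_of_nonneg_left (h s hs) (Real.exp_pos _).le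
      _ = C * (Real.exp (-(b + 1) * s) * Real.exp (b * s)) := by ring
      _ = _ := by rw [← Real.exp_add]; ring_nf

theorem LaplaceIntegrable.integrableOn_mul {φ k : ℝ → ℝ} {b C : ℝ}
    (hb : IntegrableOn (fun s => Real.exp (-b * s) * φ s) (Ioi 0))
    (hφ : AEStronglyMeasurable φ (volume.restrict (Ioi 0)))
    (hk : AEStronglyMeasurable k (volume.restrict (Ioi 0)))
    (hC : ∀ s, 0 < s → |k s| ≤ C * Real.exp (-b * s)) :
    IntegrableOn (fun s => φ s * k s) (Ioi 0) := by
  refine (hb.norm.const_mul C).mono' (hφ.mul hk) ?_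
  filter_upwards [ae_restrict_mem measurableSet_Ioi] with s hs
  rw [norm_mul, norm_mul, Real.norm_of_nonneg (Real.exp_pos _).le]
  have := mul_le_mul_of_nonneg_left (hC s hs) (norm_nonneg (φ s))
  calc _ ≤ _ := this
    _ = _ := by ring

/-- The kernel decays at any prescribed exponential rate, so the rate can be chosen after `φ`. -/
theorem LaplaceIntegrable.integrableOn_mul_wrightF {α : ℝ} (h0 : 0 < α) (h1 : α < 1) {δ : ℝ}
    (hδ : δ ≤ 1) {t : ℝ} (ht : 0 < t) {φ : ℝ → ℝ} (hφ : LaplaceIntegrable φ) :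
    IntegrableOn (fun s => φ s * wrightF α δ s t) (Ioi 0) := by
  obtain ⟨b, -, hb⟩ := hφ.eventually
  obtain ⟨C, -, hC⟩ := exists_abs_wrightF_le h0 h1 hδ b (T := t) ht
  exact integrableOn_mul hb hφ.aestronglyMeasurable
    (continuous_wrightF h0 h1 hδ ht).aestronglyMeasurable
    fun s hs => hC t s le_rfl le_rfl hs.le

theorem LaplaceIntegrable.integrableOn_mul_wrightG {α : ℝ} (h0 : 0 < α) (h1 : α < 1)
    {t : ℝ} (ht : 0 < t) {φ : ℝ → ℝ} (hφ : LaplaceIntegrable φ) :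
    IntegrableOn (fun s => φ s * wrightG α s t) (Ioi 0) := by
  simp_rw [wrightG_eq_wrightF ht]
  exact hφ.integrableOn_mul_wrightF h0 h1 (by linarith) ht

theorem LaplaceIntegrable.hasDerivAt_integral_mul_wrightG {α : ℝ} (h0 : 0 < α) (h1 : α < 1)
    {t : ℝ} (ht : 0 < t) {φ : ℝ → ℝ} (hφ : LaplaceIntegrable φ) :
    HasDerivAt (fun t => ∫ s in Ioi (0 : ℝ), φ s * wrightG α s t)
      (∫ s in Ioi (0 : ℝ), φ s * wrightF α (-α) s t) t := by
  obtain ⟨b, -, hb⟩ := hφ.eventually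
  obtain ⟨C, -, hC⟩ := exists_abs_wrightF_le h0 h1 (by linarith : -α ≤ 1) b (T₀ := t / 2)
    (T := 2 * t) (half_pos ht)
  refine (hasDerivAt_integral_of_dominated_loc_of_deriv_le
    (F := fun t s => φ s * wrightG α s t) (F' := fun t s => φ s * wrightF α (-α) s t)
    (μ := volume.restrict (Ioi 0)) (bound := fun s => C * ‖Real.exp (-b * s) * φ s‖) (s := Icc (t / 2) (2 * t))
    (Icc_mem_nhds (by linarith) (by linarith)) ?_
    (hφ.integrableOn_mul_wrightG h0 h1 ht)
    (hφ.integrableOn_mul_wrightF h0 h1 (by linarith) ht).aestronglyMeasurable ?_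
    (hb.norm.const_mul C) ?_).2
  · filter_upwards [lt_mem_nhds ht] with x hx
    exact (hφ.integrableOn_mul_wrightG h0 h1 hx).aestronglyMeasurable
  · filter_upwards [ae_restrict_mem measurableSet_Ioi] with s hs x hx
    rw [norm_mul, norm_mul, Real.norm_of_nonneg (Real.exp_pos _).le]
    have := mul_le_mul_of_nonneg_left (hC x s hx.1 hx.2 (le_of_lt hs)) (norm_nonneg (φ s))
    calc _ ≤ _ := this
      _ = _ := by ring
  · filter_upwards with s x hx
    exact (hasDerivAt_wrightG_time h0 h1 s (by linarith [hx.1])).const_mul _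

theorem wrightTransform_of_pos (α : ℝ) (f : ℝ → ℝ) {t : ℝ} (ht : 0 < t) :
    wrightTransform α f t = ∫ s in Ioi (0 : ℝ), f s * wrightG α s t := if_neg ht.ne'

/-! ### The transform in time: derivative and continuity at `0`. -/

/-- A function on the half-line with a Laplace integrable derivative. -/
structure IsLaplacePrimitive (f : ℝ → ℝ) : Prop where
  continuousOn : ContinuousOn f (Ici 0)
  differentiableAt : ∀ t > 0, DifferentiableAt ℝ f t
  integrable_deriv : ∀ t > 0, IntervalIntegrable (deriv f) volume 0 t
  laplace : LaplaceIntegrable (deriv f)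

/-- Write `f(s) = f(0) + ∫ f'` and insert `exp(b(s - r)) ≥ 1` for `r ≤ s`. Thus a Laplace integral
for the derivative already controls the function. -/
theorem IsLaplacePrimitive.exists_abs_le {f : ℝ → ℝ} (hf : IsLaplacePrimitive f) :
    ∃ C b, 0 < C ∧ 0 < b ∧ ∀ s, 0 ≤ s → |f s| ≤ C * Real.exp (b * s) := by
  obtain ⟨b, hb0, hb⟩ := hf.laplace.eventually
  set J := ∫ r in Ioi (0 : ℝ), ‖Real.exp (-b * r) * deriv f r‖ with hJ
  have hJ0 : 0 ≤ J := integral_nonneg fun r => norm_nonneg _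
  refine ⟨|f 0| + J + 1, b, by positivity, hb0, fun s hs => ?_⟩
  rcases hs.eq_or_lt with rfl | hs
  · simp; linarith
  have h1 := intervalIntegral.integral_eq_sub_of_hasDerivAt_of_le hs.le
    (hf.continuousOn.mono Icc_subset_Ici_self)
    (fun x hx => (hf.differentiableAt x hx.1).hasDerivAt) (hf.integrable_deriv s hs)
  have h2 : ‖∫ y in (0 : ℝ)..s, deriv f y‖ ≤ Real.exp (b * s) * J := by
    rw [intervalIntegral.integral_of_le hs.le]
    calc _ ≤ ∫ r in Ioc (0 : ℝ) s, Real.exp (b * s) * ‖Real.exp (-b * r) * deriv f r‖ := by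
          refine norm_integral_le_of_norm_le
            ((hb.mono_set Ioc_subset_Ioi_self).norm.const_mul _) ?_
          filter_upwards [ae_restrict_mem measurableSet_Ioc] with r hr
          rw [norm_mul, Real.norm_of_nonneg (Real.exp_pos _).le, ← mul_assoc, ← Real.exp_add]
          refine le_mul_of_one_le_left (norm_nonneg _) (Real.one_le_exp ?_)
          nlinarith [hr.2]
      _ ≤ _ := by
          rw [integral_const_mul]
          refine mul_le_mul_of_nonneg_left ?_ (Real.exp_pos _).le
          exact setIntegral_mono_set hb.norm (.of_forall fun r => norm_nonneg _)
            (Ioc_subset_Ioi_self.eventuallyLE)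
  rw [h1, Real.norm_eq_abs] at h2
  have h3 : |f s| ≤ |f s - f 0| + |f 0| := by simpa using abs_add_le (f s - f 0) (f 0)
  have h4 : 1 ≤ Real.exp (b * s) := Real.one_le_exp (by positivity)
  nlinarith [abs_nonneg (f 0)]

theorem IsLaplacePrimitive.laplaceIntegrable {f : ℝ → ℝ} (hf : IsLaplacePrimitive f) :
    LaplaceIntegrable f := by
  obtain ⟨C, b, -, -, h⟩ := hf.exists_abs_le
  exact .of_abs_le ((hf.continuousOn.mono Ioi_subset_Ici_self).aestronglyMeasurable
    measurableSet_Ioi) fun s hs => h s hs.le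

/-- Integration by parts with `∂_s F_0 = -F_{-α}`. Both boundary terms vanish: at `0` because
`F_0(0,t) = 0`, at infinity by the decay of `F_0`. Hence no term in `f(0)` appears, as the Caputo
derivative requires. -/
theorem IsLaplacePrimitive.integral_mul_wrightF_neg {f : ℝ → ℝ} (hf : IsLaplacePrimitive f)
    {α : ℝ} (h0 : 0 < α) (h1 : α < 1) {t : ℝ} (ht : 0 < t) :
    ∫ s in Ioi (0 : ℝ), f s * wrightF α (-α) s t =
      ∫ s in Ioi (0 : ℝ), deriv f s * wrightF α 0 s t := by
  obtain ⟨C, b, hC0, hb, hC⟩ := hf.exists_abs_le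
  obtain ⟨C', hC0', hC'⟩ := exists_abs_wrightF_le h0 h1 zero_le_one (b + 1) (T := t) ht
  have hF0 : wrightF α 0 0 t = 0 := by rw [wrightF_zero_eq h0 h1]; simp
  have hlim0 : Tendsto (f * fun s => wrightF α 0 s t) (𝓝[>] 0) (𝓝 0) := by
    have e1 : Tendsto f (𝓝[>] 0) (𝓝 (f 0)) :=
      (hf.continuousOn 0 self_mem_Ici).mono_left (nhdsWithin_mono _ Ioi_subset_Ici_self)
    have e2 : Tendsto (fun s => wrightF α 0 s t) (𝓝[>] 0) (𝓝 0) := by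
      have := ((continuous_wrightF h0 h1 zero_le_one ht).tendsto 0).mono_left
        (nhdsWithin_le_nhds (s := Ioi 0))
      rwa [hF0] at this
    have e3 := e1.mul e2
    rwa [mul_zero] at e3
  have hlim1 : Tendsto (f * fun s => wrightF α 0 s t) atTop (𝓝 0) := by
    have e1 : Tendsto (fun s : ℝ => C * C' * Real.exp (-s)) atTop (𝓝 0) := by
      simpa using Real.tendsto_exp_neg_atTop_nhds_zero.const_mul (C * C')
    refine squeeze_zero_norm' ?_ e1
    filter_upwards [eventually_ge_atTop 0] with s hs
    rw [Pi.mul_apply, norm_mul]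
    calc _ ≤ (C * Real.exp (b * s)) * (C' * Real.exp (-(b + 1) * s)) :=
          mul_le_mul (hC s hs) (hC' t s le_rfl le_rfl hs) (abs_nonneg _) (by positivity)
      _ = C * C' * (Real.exp (b * s) * Real.exp (-(b + 1) * s)) := by ring
      _ = _ := by rw [← Real.exp_add]; ring_nf
  have hi1 := hf.laplaceIntegrable.integrableOn_mul_wrightF h0 h1 (by linarith : -α ≤ 1) ht
  have key := integral_Ioi_mul_deriv_eq_deriv_mul
    (u := f) (v := fun s => wrightF α 0 s t) (u' := deriv f)
    (v' := fun s => -wrightF α (-α) s t)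
    (fun x hx => (hf.differentiableAt x hx).hasDerivAt)
    (fun x _ => by simpa using hasDerivAt_wrightF_space h0 h1 zero_le_one x ht)
    (hi1.neg.congr (.of_forall fun s => by simp))
    (hf.laplace.integrableOn_mul_wrightF h0 h1 zero_le_one ht) hlim0 hlim1
  simp only [mul_neg, integral_neg, sub_zero, zero_sub, neg_inj] at key
  exact key

theorem IsLaplacePrimitive.hasDerivAt_wrightTransform {f : ℝ → ℝ} (hf : IsLaplacePrimitive f)
    {α : ℝ} (h0 : 0 < α) (h1 : α < 1) {t : ℝ} (ht : 0 < t) :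
    HasDerivAt (wrightTransform α f) (∫ s in Ioi (0 : ℝ), deriv f s * wrightF α 0 s t) t := by
  rw [← hf.integral_mul_wrightF_neg h0 h1 ht]
  refine (hf.laplaceIntegrable.hasDerivAt_integral_mul_wrightG h0 h1 ht).congr_of_eventuallyEq ?_
  filter_upwards [lt_mem_nhds ht] with x hx
  exact wrightTransform_of_pos α f hx

/-- The substitution `s = t^α z` puts all dependence on `t` into the argument of `f`, leaving a
fixed density for the limit `t → 0`. -/
theorem wrightTransform_eq_integral_comp {α : ℝ} (f : ℝ → ℝ) {t : ℝ} (ht : 0 < t) :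
    wrightTransform α f t = ∫ z in Ioi (0 : ℝ), f (t ^ α * z) * wrightW (-α) (1 - α) (-z) := by
  have hp : 0 < t ^ α := Real.rpow_pos_of_pos ht α
  have := integral_comp_mul_left_Ioi (fun s => f s * wrightW (-α) (1 - α) (-(s / t ^ α))) 0 hp
  simp only [mul_div_cancel_left₀ _ hp.ne', mul_zero, smul_eq_mul] at this
  rw [this, wrightTransform_of_pos α f ht, ← integral_const_mul]
  refine integral_congr_ae (.of_forall fun s => ?_)
  simp only [wrightG, neg_div]
  ring

theorem IsLaplacePrimitive.continuousOn_wrightTransform {f : ℝ → ℝ} (hf : IsLaplacePrimitive f)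
    {α : ℝ} (h0 : 0 < α) (h1 : α < 1) : ContinuousOn (wrightTransform α f) (Ici 0) := by
  intro t ht
  rcases (mem_Ici.1 ht).eq_or_lt with rfl | ht
  swap
  · exact (hf.hasDerivAt_wrightTransform h0 h1 ht).continuousAt.continuousWithinAt
  rw [← continuousWithinAt_Ioi_iff_Ici]
  obtain ⟨C, b, hC0, hb, hC⟩ := hf.exists_abs_le
  obtain ⟨C', hC0', hC'⟩ := exists_abs_wrightW_le h0 h1 (by linarith : 1 - α ≤ 1) (b + 1)
  -- Unit mass of the density identifies the prescribed value `f 0` with the limit integral.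
  have hval : wrightTransform α f 0 = ∫ z in Ioi (0 : ℝ), f 0 * wrightW (-α) (1 - α) (-z) := by
    rw [integral_const_mul, integral_wrightW_neg h0 h1, mul_one, wrightTransform, if_pos rfl]
  rw [ContinuousWithinAt, hval]
  have heq : (fun t => ∫ z in Ioi (0 : ℝ), f (t ^ α * z) * wrightW (-α) (1 - α) (-z))
      =ᶠ[𝓝[>] 0] wrightTransform α f := by
    filter_upwards [self_mem_nhdsWithin] with t ht
    exact (wrightTransform_eq_integral_comp f ht).symm
  refine Tendsto.congr' heq ?_
  refine tendsto_integral_filter_of_dominated_convergence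
    (fun z => C * C' * Real.exp (-1 * z)) ?_ ?_ ?_ ?_
  · filter_upwards [self_mem_nhdsWithin] with t ht
    have hp : 0 < t ^ α := Real.rpow_pos_of_pos ht α
    refine AEStronglyMeasurable.mul ?_
      (continuous_wrightW_neg h0 h1 (by linarith)).aestronglyMeasurable
    refine ContinuousOn.aestronglyMeasurable ?_ measurableSet_Ioi
    exact hf.continuousOn.comp (by fun_prop) fun z hz => (mul_pos hp hz).le
  · filter_upwards [Ioo_mem_nhdsGT one_pos] with t ht
    filter_upwards [ae_restrict_mem measurableSet_Ioi] with z hz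
    rw [mem_Ioi] at hz
    have hp : 0 < t ^ α := Real.rpow_pos_of_pos ht.1 α
    have hp1 : t ^ α ≤ 1 := Real.rpow_le_one ht.1.le ht.2.le h0.le
    rw [norm_mul]
    calc _ ≤ (C * Real.exp (b * (t ^ α * z))) * (C' * Real.exp (-(b + 1) * z)) :=
          mul_le_mul (hC _ (by positivity)) (hC' z hz.le) (abs_nonneg _) (by positivity)
      _ ≤ (C * Real.exp (b * (1 * z))) * (C' * Real.exp (-(b + 1) * z)) := by gcongr
      _ = C * C' * (Real.exp (b * (1 * z)) * Real.exp (-(b + 1) * z)) := by ring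
      _ = _ := by rw [← Real.exp_add]; ring_nf
  · exact (exp_neg_integrableOn_Ioi 0 one_pos).const_mul _
  · filter_upwards [ae_restrict_mem measurableSet_Ioi] with z hz
    rw [mem_Ioi] at hz
    refine Tendsto.mul_const _ ?_
    have e1 : Tendsto (fun t : ℝ => t ^ α * z) (𝓝[>] 0) (𝓝[≥] 0) := by
      refine tendsto_nhdsWithin_of_tendsto_nhds_of_eventually_within _ ?_ ?_
      · have : ContinuousAt (fun t : ℝ => t ^ α * z) 0 :=
          (Real.continuousAt_rpow_const 0 α (Or.inr h0.le)).mul continuousAt_const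
        have h2 := this.tendsto
        simp only [Real.zero_rpow h0.ne', zero_mul] at h2
        exact h2.mono_left nhdsWithin_le_nhds
      · filter_upwards [self_mem_nhdsWithin] with t ht
        exact (mul_pos (Real.rpow_pos_of_pos ht α) hz).le
    exact (hf.continuousOn 0 self_mem_Ici).tendsto.comp e1

/-! ### Fubini and the Caputo derivative of the transform. -/

/-- The integrand is the `τ`-derivative of `exp(-s τ^(-α))`, which increases from `0` and stays
below `1`. The bound is uniform in `s`, although the integrand concentrates near `τ = 0` as `s → 0`.
-/
theorem integrableOn_rpow_mul_exp_neg_div {α s t : ℝ} (h0 : 0 < α) (hs : 0 < s) (ht : 0 < t) :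
    IntegrableOn (fun τ => α * s / τ * (1 / τ ^ α) * Real.exp (-(s / τ ^ α))) (Ioc 0 t) ∧
      ∫ τ in Ioc (0 : ℝ) t, α * s / τ * (1 / τ ^ α) * Real.exp (-(s / τ ^ α)) ≤ 1 := by
  -- The value at `0` must be set by hand: there the formula `exp(-(s / τ^α))` evaluates to `1`,
  -- since division by zero gives `0`, whereas its limit is `0`.
  let φ : ℝ → ℝ := fun τ => if τ ≤ 0 then 0 else Real.exp (-(s / τ ^ α))
  have hφ : ∀ τ, 0 < τ → φ =ᶠ[𝓝 τ] fun τ => Real.exp (-(s * τ ^ (-α))) := by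
    intro τ hτ
    filter_upwards [lt_mem_nhds hτ] with x hx
    simp only [φ, if_neg (not_le.2 hx), Real.rpow_neg hx.le, div_eq_mul_inv]
  have hd : ∀ τ ∈ Ioo 0 t,
      HasDerivAt φ (α * s / τ * (1 / τ ^ α) * Real.exp (-(s / τ ^ α))) τ := by
    intro τ hτ
    have hp : HasDerivAt (fun t : ℝ => t ^ (-α)) (-α * τ ^ (-α - 1)) τ :=
      Real.hasDerivAt_rpow_const (Or.inl hτ.1.ne')
    refine ((hp.const_mul s).neg.exp.congr_deriv ?_).congr_of_eventuallyEq (hφ τ hτ.1)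
    simp only [Pi.neg_apply]
    rw [Real.rpow_sub_one hτ.1.ne', Real.rpow_neg hτ.1.le]
    simp only [div_eq_mul_inv]
    ring
  have hc : ContinuousOn φ (Icc 0 t) := by
    intro τ hτ
    rcases hτ.1.eq_or_lt with rfl | h
    · refine ContinuousWithinAt.mono ?_ Icc_subset_Ici_self
      rw [← continuousWithinAt_Ioi_iff_Ici, ContinuousWithinAt]
      have e1 : Tendsto (fun τ : ℝ => Real.exp (-(s * τ ^ (-α)))) (𝓝[>] 0) (𝓝 0) :=
        Real.tendsto_exp_neg_atTop_nhds_zero.comp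
          ((tendsto_rpow_neg_nhdsGT_zero (neg_lt_zero.2 h0)).const_mul_atTop hs)
      simp only [φ, le_refl, if_true]
      refine e1.congr' ?_
      filter_upwards [self_mem_nhdsWithin] with x hx
      exact (hφ x hx).symm.eq_of_nhds
    · have e1 : ContinuousAt (fun τ : ℝ => Real.exp (-(s * τ ^ (-α)))) τ :=
        ((continuousAt_const.mul (Real.continuousAt_rpow_const τ _ (Or.inl h.ne'))).neg).rexp
      exact (e1.congr (hφ τ h).symm).continuousWithinAt
  have hnn : ∀ τ ∈ Ioo 0 t, 0 ≤ α * s / τ * (1 / τ ^ α) * Real.exp (-(s / τ ^ α)) := by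
    intro τ hτ
    have := hτ.1
    positivity
  have hI := intervalIntegral.integrableOn_deriv_of_nonneg hc hd hnn
  refine ⟨hI, ?_⟩
  rw [← intervalIntegral.integral_of_le ht.le, intervalIntegral.integral_eq_sub_of_hasDerivAt_of_le
    ht.le hc hd ((intervalIntegrable_iff_integrableOn_Ioc_of_le ht.le).2 hI)]
  simp only [φ, le_refl, if_true, if_neg (not_le.2 ht), sub_zero]
  exact Real.exp_le_one_iff.2 (by have := Real.rpow_pos_of_pos ht α; rw [neg_nonpos]; positivity)

theorem integrableOn_sub_rpow {c t : ℝ} (hc : c < 1) (ht : 0 < t) :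
    IntegrableOn (fun τ : ℝ => (t - τ) ^ (-c)) (Ioc 0 t) := by
  have := intervalIntegrable_sub_rpow (γ := 1 - c) (by linarith) t
  rw [show 1 - c - 1 = -c by ring] at this
  exact (intervalIntegrable_iff_integrableOn_Ioc_of_le ht.le).1 this

/-- Split at `t/2`. On the left the weight is bounded and `F_0` is majorized by `exp(-b s)` times an
exact derivative of integral at most `1`; on the right `F_0` is bounded by a multiple of `exp(-b s)`
and the weight is integrable. The factor `exp(-b s)` pays for the growth of `φ` in Fubini's theorem.
-/
theorem exists_integral_abs_wrightF_zero_le {α c t : ℝ} (h0 : 0 < α) (h1 : α < 1) (hc0 : 0 ≤ c)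
    (hc1 : c < 1) (ht : 0 < t) {b : ℝ} (hb : 0 < b) :
    ∃ A, ∀ s, 0 < s →
      IntegrableOn (fun τ => (t - τ) ^ (-c) * wrightF α 0 s τ) (Ioc 0 t) ∧
      ∫ τ in Ioc (0 : ℝ) t, ‖(t - τ) ^ (-c) * wrightF α 0 s τ‖ ≤ A * Real.exp (-b * s) := by
  -- The part `b t^α` of the rate gives `exp(-b s)` for all `τ ≤ t`; the extra `1` leaves the factor
  -- `exp(-s / τ^α)`.
  obtain ⟨C, hC0, hC⟩ := exists_abs_wrightW_le h0 h1 (by linarith : 1 - α ≤ 1) (b * t ^ α + 1)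
  obtain ⟨C', hC0', hC'⟩ := exists_abs_wrightF_le h0 h1 zero_le_one b (T := t) (half_pos ht)
  have hI := integrableOn_sub_rpow hc1 ht
  set J := ∫ τ in Ioc (0 : ℝ) t, (t - τ) ^ (-c) with hJ
  refine ⟨(t / 2) ^ (-c) * C + C' * J, fun s hs => ?_⟩
  obtain ⟨hD, hD1⟩ := integrableOn_rpow_mul_exp_neg_div h0 hs ht
  set D : ℝ → ℝ := fun τ => α * s / τ * (1 / τ ^ α) * Real.exp (-(s / τ ^ α)) with hDdef
  have hbound : ∀ τ ∈ Ioc (0 : ℝ) t, ‖(t - τ) ^ (-c) * wrightF α 0 s τ‖ ≤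
      Real.exp (-b * s) * ((t / 2) ^ (-c) * C * D τ + C' * (t - τ) ^ (-c)) := by
    intro τ hτ
    have hτ0 := hτ.1
    have hsub : 0 ≤ t - τ := by linarith [hτ.2]
    have hDn : 0 ≤ D τ := by simp only [hDdef]; positivity
    have hw : 0 ≤ (t - τ) ^ (-c) := Real.rpow_nonneg hsub _
    rw [norm_mul, Real.norm_of_nonneg hw]
    rcases le_total τ (t / 2) with hle | hle
    · have e1 : |wrightF α 0 s τ| ≤ Real.exp (-b * s) * (C * D τ) := by
        have hp : 0 < τ ^ α := by positivity
        have e2 := hC (s / τ ^ α) (by positivity)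
        have e3 : Real.exp (-(b * t ^ α + 1) * (s / τ ^ α)) ≤
            Real.exp (-b * s) * Real.exp (-(s / τ ^ α)) := by
          rw [← Real.exp_add]
          refine Real.exp_le_exp.2 ?_
          have e4 : τ ^ α ≤ t ^ α := Real.rpow_le_rpow hτ0.le hτ.2 h0.le
          have e5 : s ≤ t ^ α * (s / τ ^ α) := by
            rw [mul_div_assoc', le_div_iff₀ hp]; nlinarith
          nlinarith [mul_le_mul_of_nonneg_left e5 hb.le]
        rw [wrightF_zero_eq h0 h1, wrightG, neg_div, abs_mul, abs_mul,
          abs_of_pos (by positivity : 0 < α * s / τ), abs_of_pos (by positivity : 0 < 1 / τ ^ α)]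
        calc _ ≤ α * s / τ * (1 / τ ^ α * (C * (Real.exp (-b * s) * Real.exp (-(s / τ ^ α))))) := by
              gcongr
              exact e2.trans (mul_le_mul_of_nonneg_left e3 hC0.le)
          _ = _ := by simp only [hDdef]; ring
      have e6 : (t - τ) ^ (-c) ≤ (t / 2) ^ (-c) :=
        Real.rpow_le_rpow_of_nonpos (by positivity) (by linarith) (by linarith)
      calc _ ≤ (t / 2) ^ (-c) * (Real.exp (-b * s) * (C * D τ)) :=
            mul_le_mul e6 e1 (abs_nonneg _) (by positivity)
        _ = Real.exp (-b * s) * ((t / 2) ^ (-c) * C * D τ) := by ring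
        _ ≤ _ := by
            refine mul_le_mul_of_nonneg_left (le_add_of_nonneg_right ?_) (Real.exp_pos _).le
            positivity
    · calc _ ≤ (t - τ) ^ (-c) * (C' * Real.exp (-b * s)) :=
            mul_le_mul_of_nonneg_left (hC' τ s hle hτ.2 hs.le) hw
        _ = Real.exp (-b * s) * (C' * (t - τ) ^ (-c)) := by ring
        _ ≤ _ := by
            refine mul_le_mul_of_nonneg_left (le_add_of_nonneg_left ?_) (Real.exp_pos _).le
            positivity
  have hBI : IntegrableOn (fun τ => Real.exp (-b * s) *
      ((t / 2) ^ (-c) * C * D τ + C' * (t - τ) ^ (-c))) (Ioc 0 t) :=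
    ((hD.const_mul _).add (hI.const_mul _)).const_mul _
  have hm : AEStronglyMeasurable (fun τ => (t - τ) ^ (-c) * wrightF α 0 s τ)
      (volume.restrict (Ioc 0 t)) := by
    refine Measurable.aestronglyMeasurable (Measurable.mul (by fun_prop) ?_)
    exact (measurable_wrightF h0 h1 zero_le_one).comp measurable_prodMk_left
  have hae : ∀ᵐ τ ∂(volume.restrict (Ioc 0 t)), ‖(t - τ) ^ (-c) * wrightF α 0 s τ‖ ≤
      Real.exp (-b * s) * ((t / 2) ^ (-c) * C * D τ + C' * (t - τ) ^ (-c)) := by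
    filter_upwards [ae_restrict_mem measurableSet_Ioc] with τ hτ using hbound τ hτ
  have hFI : IntegrableOn (fun τ => (t - τ) ^ (-c) * wrightF α 0 s τ) (Ioc 0 t) :=
    hBI.mono' hm hae
  refine ⟨hFI, (integral_mono_ae hFI.norm hBI hae).trans ?_⟩
  rw [integral_const_mul, integral_add (hD.const_mul _) (hI.const_mul _), integral_const_mul,
    integral_const_mul, mul_comm]
  refine mul_le_mul_of_nonneg_right ?_ (Real.exp_pos _).le
  have : (t / 2) ^ (-c) * C * ∫ τ in Ioc (0 : ℝ) t, D τ ≤ (t / 2) ^ (-c) * C * 1 :=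
    mul_le_mul_of_nonneg_left hD1 (by positivity)
  linarith

theorem LaplaceIntegrable.integrable_prod_wrightF_zero {φ : ℝ → ℝ} (hφ : LaplaceIntegrable φ)
    {α c t : ℝ} (h0 : 0 < α) (h1 : α < 1) (hc0 : 0 ≤ c) (hc1 : c < 1) (ht : 0 < t) :
    Integrable (Function.uncurry fun s τ => φ s * ((t - τ) ^ (-c) * wrightF α 0 s τ))
      ((volume.restrict (Ioi 0)).prod (volume.restrict (Ioc 0 t))) := by
  obtain ⟨b, hb0, hb⟩ := hφ.eventually
  obtain ⟨A, hA⟩ := exists_integral_abs_wrightF_zero_le h0 h1 hc0 hc1 ht hb0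
  have hm : AEStronglyMeasurable
      (Function.uncurry fun s τ => φ s * ((t - τ) ^ (-c) * wrightF α 0 s τ))
      ((volume.restrict (Ioi 0)).prod (volume.restrict (Ioc 0 t))) := by
    refine AEStronglyMeasurable.mul hφ.aestronglyMeasurable.comp_fst ?_
    exact (Measurable.mul (by fun_prop) (measurable_wrightF h0 h1 zero_le_one)).aestronglyMeasurable
  rw [integrable_prod_iff hm]
  constructor
  · filter_upwards [ae_restrict_mem measurableSet_Ioi] with s hs
    exact (hA s hs).1.const_mul (φ s)
  · refine (hb.norm.const_mul A).mono' hm.norm.integral_prod_right' ?_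
    filter_upwards [ae_restrict_mem measurableSet_Ioi] with s hs
    simp only [Function.uncurry_apply_pair]
    rw [Real.norm_of_nonneg (integral_nonneg fun _ => norm_nonneg _)]
    simp_rw [norm_mul (φ s)]
    rw [integral_const_mul, norm_mul, Real.norm_of_nonneg (Real.exp_pos _).le]
    calc _ ≤ ‖φ s‖ * (A * Real.exp (-b * s)) :=
          mul_le_mul_of_nonneg_left (hA s hs).2 (norm_nonneg _)
      _ = _ := by ring

/-- With `c = 0` this gives integrability of the time derivative of the transform, with `c = βα`
that of the Caputo integrand. -/
theorem LaplaceIntegrable.integrableOn_sub_rpow_mul {φ : ℝ → ℝ} (hφ : LaplaceIntegrable φ)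
    {α c t : ℝ} (h0 : 0 < α) (h1 : α < 1) (hc0 : 0 ≤ c) (hc1 : c < 1) (ht : 0 < t) :
    IntegrableOn (fun τ => (t - τ) ^ (-c) * ∫ s in Ioi (0 : ℝ), φ s * wrightF α 0 s τ)
      (Ioc 0 t) := by
  refine (hφ.integrable_prod_wrightF_zero h0 h1 hc0 hc1 ht).integral_prod_right.congr
    (.of_forall fun τ => ?_)
  simp only [Function.uncurry_apply_pair]
  rw [← integral_const_mul]
  refine integral_congr_ae (.of_forall fun s => ?_)
  simp only
  ring

theorem LaplaceIntegrable.integral_sub_rpow_mul {φ : ℝ → ℝ} (hφ : LaplaceIntegrable φ)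
    {α c t : ℝ} (h0 : 0 < α) (h1 : α < 1) (hc0 : 0 < c) (hc1 : c < 1) (ht : 0 < t) :
    ∫ τ in Ioc (0 : ℝ) t, (t - τ) ^ (-c) * ∫ s in Ioi (0 : ℝ), φ s * wrightF α 0 s τ =
      Real.Gamma (1 - c) * ∫ s in Ioi (0 : ℝ), φ s * wrightF α (1 - c) s t := by
  have hswap := integral_integral_swap (hφ.integrable_prod_wrightF_zero h0 h1 hc0.le hc1 ht)
  rw [← integral_const_mul]
  calc _ = ∫ τ in Ioc (0 : ℝ) t, ∫ s in Ioi (0 : ℝ), φ s * ((t - τ) ^ (-c) * wrightF α 0 s τ) := by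
        refine integral_congr_ae (.of_forall fun τ => ?_)
        simp only
        rw [← integral_const_mul]
        refine integral_congr_ae (.of_forall fun s => ?_)
        simp only
        ring
    _ = _ := hswap.symm
    _ = _ := by
        refine setIntegral_congr_fun measurableSet_Ioi fun s hs => ?_
        have := integral_sub_rpow_mul_wrightF_zero (γ := 1 - c) h0 h1 (by linarith) (by linarith)
          hs ht
        rw [show 1 - c - 1 = -c by ring] at this
        rw [integral_const_mul, this]
        ring

/-- Fubini for the fractional integral against `g_α`. -/
theorem LaplaceIntegrable.integral_mul_wrightF_sub {φ : ℝ → ℝ} (hφ : LaplaceIntegrable φ)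
    {α β t : ℝ} (h0 : 0 < α) (h1 : α < 1) (hβ0 : 0 < β) (hβ1 : β < 1) (ht : 0 < t) :
    Real.Gamma (1 - β) * ∫ s in Ioi (0 : ℝ), φ s * wrightF α (1 - β * α) s t =
      ∫ r in Ioi (0 : ℝ), (∫ τ in Ioc (0 : ℝ) r, (r - τ) ^ (-β) * φ τ) * wrightG α r t := by
  obtain ⟨b, hb0, hb⟩ := hφ.eventually
  obtain ⟨C, hC0, hC⟩ := exists_abs_wrightF_le h0 h1 (by linarith : 1 - α ≤ 1) b (T := t) ht
  -- The exponentials in `p(s)`, `q(r - s)` and `k(r)` multiply to `1`. With them `p` and `q` are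
  -- integrable and `k` is bounded, so absolute convergence reduces to that of a convolution of two
  -- integrable functions.
  let p : ℝ → ℝ := (Ioi 0).indicator fun s => Real.exp (-b * s) * φ s
  let q : ℝ → ℝ := (Ioi 0).indicator fun v => v ^ (-β) * Real.exp (-b * v)
  let k : ℝ → ℝ := (Ioi 0).indicator fun r => Real.exp (b * r) * wrightG α r t
  have hp : Integrable p := (integrable_indicator_iff measurableSet_Ioi).2 hb
  have hq : Integrable q := by
    refine (integrable_indicator_iff measurableSet_Ioi).2 ?_
    have := integrableOn_rpow_mul_exp_neg_mul_rpow (s := -β) (by linarith) one_pos hb0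
    simpa only [Real.rpow_one] using this
  have hcont : Continuous fun r => wrightG α r t := by
    simp_rw [wrightG_eq_wrightF ht]
    exact continuous_wrightF h0 h1 (by linarith) ht
  have hk : Measurable k := by
    refine Measurable.indicator ?_ measurableSet_Ioi
    exact (Continuous.mul (by fun_prop) hcont).measurable
  have hkb : ∀ r, ‖k r‖ ≤ C := by
    intro r
    by_cases hr : r ∈ Ioi (0 : ℝ)
    · simp only [k, indicator_of_mem hr]
      rw [norm_mul, Real.norm_of_nonneg (Real.exp_pos _).le, wrightG_eq_wrightF ht]
      calc _ ≤ Real.exp (b * r) * (C * Real.exp (-b * r)) :=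
            mul_le_mul_of_nonneg_left (hC t r le_rfl le_rfl (le_of_lt hr)) (Real.exp_pos _).le
        _ = C * (Real.exp (b * r) * Real.exp (-b * r)) := by ring
        _ = C := by rw [← Real.exp_add]; simp
    · simp only [k, indicator_of_notMem hr, norm_zero, hC0.le]
  have hconv := (hp.convolution_integrand (ContinuousLinearMap.mul ℝ ℝ) hq (μ := volume)
    (ν := volume))
  simp only [ContinuousLinearMap.mul_apply'] at hconv
  have hint : Integrable (Function.uncurry fun r s => k r * (p s * q (r - s)))
      (volume.prod volume) :=
    hconv.bdd_mul (hk.comp measurable_fst).aestronglyMeasurable (.of_forall fun x => hkb x.1)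
  have hswap := integral_integral_swap hint
  have hleft : ∫ r, ∫ s, k r * (p s * q (r - s)) =
      ∫ r in Ioi (0 : ℝ), (∫ τ in Ioc (0 : ℝ) r, (r - τ) ^ (-β) * φ τ) * wrightG α r t := by
    rw [← integral_indicator measurableSet_Ioi]
    refine integral_congr_ae (.of_forall fun r => ?_)
    by_cases hr : r ∈ Ioi (0 : ℝ)
    · simp only [indicator_of_mem hr, k]
      rw [← integral_mul_const, integral_Ioc_eq_integral_Ioo,
        ← integral_indicator measurableSet_Ioo]
      refine integral_congr_ae (.of_forall fun s => ?_)
      by_cases hs : s ∈ Ioo (0 : ℝ) r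
      · have e1 : s ∈ Ioi (0 : ℝ) := hs.1
        have e2 : r - s ∈ Ioi (0 : ℝ) := sub_pos.2 hs.2
        simp only [indicator_of_mem hs, p, q, indicator_of_mem e1, indicator_of_mem e2]
        have e3 : Real.exp (b * r) * Real.exp (-b * s) * Real.exp (-b * (r - s)) = 1 := by
          rw [← Real.exp_add, ← Real.exp_add, Real.exp_eq_one_iff]; ring
        linear_combination wrightG α r t * φ s * (r - s) ^ (-β) * e3
      · simp only [indicator_of_notMem hs]
        by_cases e1 : s ∈ Ioi (0 : ℝ)
        · have e2 : r - s ∉ Ioi (0 : ℝ) := fun h => hs ⟨e1, sub_pos.1 h⟩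
          simp [q, indicator_of_notMem e2]
        · simp [p, indicator_of_notMem e1]
    · simp [k, indicator_of_notMem hr]
  have hright : ∫ s, ∫ r, k r * (p s * q (r - s)) =
      Real.Gamma (1 - β) * ∫ s in Ioi (0 : ℝ), φ s * wrightF α (1 - β * α) s t := by
    rw [← integral_const_mul, ← integral_indicator measurableSet_Ioi]
    refine integral_congr_ae (.of_forall fun s => ?_)
    by_cases hs : s ∈ Ioi (0 : ℝ)
    · simp only [indicator_of_mem hs]
      rw [mul_left_comm, ← integral_rpow_mul_wrightG h0 h1 hβ0 hβ1 ht, ← integral_const_mul,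
        ← integral_indicator measurableSet_Ioi,
        ← integral_sub_right_eq_self ((Ioi (0 : ℝ)).indicator _) s]
      refine integral_congr_ae (.of_forall fun r => ?_)
      by_cases hr : r - s ∈ Ioi (0 : ℝ)
      · have e1 : r ∈ Ioi (0 : ℝ) := by
          have := mem_Ioi.1 hr; have := mem_Ioi.1 hs; rw [mem_Ioi]; linarith
        simp only [p, q, k, indicator_of_mem hr, indicator_of_mem hs, indicator_of_mem e1]
        have e3 : Real.exp (b * r) * Real.exp (-b * s) * Real.exp (-b * (r - s)) = 1 := by
          rw [← Real.exp_add, ← Real.exp_add, Real.exp_eq_one_iff]; ring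
        rw [add_sub_cancel]
        linear_combination wrightG α r t * φ s * (r - s) ^ (-β) * e3
      · simp [q, indicator_of_notMem hr]
    · simp [p, indicator_of_notMem hs]
  rw [← hleft, ← hright, hswap]

/-- The Caputo derivative of order `β α` of the transform is the transform of that of order `β`. -/
theorem IsLaplacePrimitive.caputoDeriv_wrightTransform {f : ℝ → ℝ} (hf : IsLaplacePrimitive f)
    {α β t : ℝ} (h0 : 0 < α) (h1 : α < 1) (hβ0 : 0 < β) (hβ1 : β ≤ 1) (ht : 0 < t) :
    caputoDeriv (β * α) (wrightTransform α f) t =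
      ∫ s in Ioi (0 : ℝ), caputoDeriv β f s * wrightG α s t := by
  have hc0 : 0 < β * α := mul_pos hβ0 h0
  have hc1 : β * α < 1 := by nlinarith
  have hG : 0 < Real.Gamma (1 - β * α) := Real.Gamma_pos_of_pos (by linarith)
  have hL : caputoDeriv (β * α) (wrightTransform α f) t =
      ∫ s in Ioi (0 : ℝ), deriv f s * wrightF α (1 - β * α) s t := by
    rw [caputoDeriv, fracIntegral, if_neg (by linarith), intervalIntegral.integral_of_le ht.le]
    have := hf.laplace.integral_sub_rpow_mul h0 h1 hc0 hc1 ht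
    rw [show 1 - β * α - 1 = -(β * α) by ring, setIntegral_congr_fun measurableSet_Ioc
      (fun τ hτ => by rw [(hf.hasDerivAt_wrightTransform h0 h1 hτ.1).deriv]), this]
    field_simp
  rw [hL]
  -- For `β = 1` the Caputo derivative is `f'` itself and `F_{1-βα}` is already `g_α`.
  rcases hβ1.eq_or_lt with rfl | hβ1
  · simp_rw [caputoDeriv, fracIntegral, sub_self, if_true, one_mul, wrightG_eq_wrightF ht]
  · have hG' : 0 < Real.Gamma (1 - β) := Real.Gamma_pos_of_pos (by linarith)
    have := hf.laplace.integral_mul_wrightF_sub h0 h1 hβ0 hβ1 ht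
    refine mul_left_cancel₀ hG'.ne' (this.trans ?_)
    rw [← integral_const_mul]
    refine setIntegral_congr_fun measurableSet_Ioi fun r hr => ?_
    rw [caputoDeriv, fracIntegral, if_neg (by linarith),
      intervalIntegral.integral_of_le (le_of_lt hr), show 1 - β - 1 = -β by ring]
    field_simp

/-! ### Space derivatives under the integral sign. -/

theorem LaplaceIntegrable.mono {φ h : ℝ → ℝ} (hh : LaplaceIntegrable h)
    (hm : AEStronglyMeasurable φ (volume.restrict (Ioi 0))) (hle : ∀ s > 0, |φ s| ≤ h s) :
    LaplaceIntegrable φ := by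
  obtain ⟨a, ha⟩ := hh
  refine ⟨a, ha.mono' ?_ ?_⟩
  · exact (by fun_prop : Continuous fun s : ℝ => Real.exp (-a * s)).aestronglyMeasurable.mul hm
  · filter_upwards [ae_restrict_mem measurableSet_Ioi] with s hs
    rw [norm_mul, Real.norm_of_nonneg (Real.exp_pos _).le]
    exact mul_le_mul_of_nonneg_left (hle s hs) (Real.exp_pos _).le

/-- The derivative of a family in a parameter inherits measurability. -/
theorem aestronglyMeasurable_of_hasDerivAt {w : ℝ → ℝ → ℝ} {w' : ℝ → ℝ} {x : ℝ} {N : Set ℝ}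
    {μ : Measure ℝ} (hN : N ∈ 𝓝 x) (hm : ∀ y ∈ N, AEStronglyMeasurable (w y) μ)
    (hd : ∀ᵐ s ∂μ, HasDerivAt (fun y => w y s) (w' s) x) : AEStronglyMeasurable w' μ := by
  classical
  -- The derivative is a limit of difference quotients, set to `0` where `x + i` leaves `N`, since
  -- measurability is known only inside `N`.
  refine aestronglyMeasurable_of_tendsto_ae (𝓝[≠] (0 : ℝ))
    (f := fun i s => if x + i ∈ N then i⁻¹ * (w (x + i) s - w x s) else 0) (fun i => ?_) ?_
  · by_cases hi : x + i ∈ N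
    · simp only [if_pos hi]
      exact ((hm _ hi).sub (hm _ (mem_of_mem_nhds hN))).const_mul _
    · simp only [if_neg hi]
      exact aestronglyMeasurable_const
  · have hmem : ∀ᶠ i in 𝓝[≠] (0 : ℝ), x + i ∈ N := by
      have : Tendsto (fun i : ℝ => x + i) (𝓝 0) (𝓝 x) := by
        simpa using (continuous_const.add continuous_id).tendsto (f := fun i : ℝ => x + i) 0
      exact (this.eventually hN).filter_mono nhdsWithin_le_nhds
    filter_upwards [hd] with s hs
    refine (hasDerivAt_iff_tendsto_slope_zero.1 hs).congr' ?_
    filter_upwards [hmem] with i hi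
    rw [if_pos hi, smul_eq_mul]

/-- Domination by `h` gives the size; measurability in `s` is inherited from the undifferentiated
family. -/
theorem LaplaceIntegrable.of_hasDerivAt {w w' : ℝ → ℝ → ℝ} {h : ℝ → ℝ} {N : Set ℝ}
    (hN : IsOpen N) (hh : LaplaceIntegrable h) (hw : ∀ y ∈ N, LaplaceIntegrable (w y))
    (hd : ∀ y ∈ N, ∀ s > 0, HasDerivAt (fun y => w y s) (w' y s) y)
    (hle : ∀ y ∈ N, ∀ s > 0, |w' y s| ≤ h s) {x : ℝ} (hx : x ∈ N) :
    LaplaceIntegrable (w' x) := by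
  refine hh.mono ?_ (hle x hx)
  refine aestronglyMeasurable_of_hasDerivAt (hN.mem_nhds hx)
    (fun y hy => (hw y hy).aestronglyMeasurable) ?_
  filter_upwards [ae_restrict_mem measurableSet_Ioi] with s hs using hd x hx s hs

theorem hasDerivAt_integral_mul_wrightG_param {α t : ℝ} (h0 : 0 < α) (h1 : α < 1) (ht : 0 < t)
    {w w' : ℝ → ℝ → ℝ} {h : ℝ → ℝ} {N : Set ℝ}
    (hN : IsOpen N) (hh : LaplaceIntegrable h) (hw : ∀ y ∈ N, LaplaceIntegrable (w y))
    (hd : ∀ y ∈ N, ∀ s > 0, HasDerivAt (fun y => w y s) (w' y s) y)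
    (hle : ∀ y ∈ N, ∀ s > 0, |w' y s| ≤ h s) {x : ℝ} (hx : x ∈ N) :
    HasDerivAt (fun y => ∫ s in Ioi (0 : ℝ), w y s * wrightG α s t)
      (∫ s in Ioi (0 : ℝ), w' x s * wrightG α s t) x := by
  have hw' := LaplaceIntegrable.of_hasDerivAt hN hh hw hd hle hx
  refine (hasDerivAt_integral_of_dominated_loc_of_deriv_le
    (F := fun y s => w y s * wrightG α s t) (F' := fun y s => w' y s * wrightG α s t)
    (μ := volume.restrict (Ioi 0)) (bound := fun s => ‖h s * wrightG α s t‖)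
    (hN.mem_nhds hx) ?_ ((hw x hx).integrableOn_mul_wrightG h0 h1 ht)
    (hw'.integrableOn_mul_wrightG h0 h1 ht).aestronglyMeasurable ?_
    (hh.integrableOn_mul_wrightG h0 h1 ht).norm ?_).2
  · filter_upwards [hN.mem_nhds hx] with y hy
    exact ((hw y hy).integrableOn_mul_wrightG h0 h1 ht).aestronglyMeasurable
  · filter_upwards [ae_restrict_mem measurableSet_Ioi] with s hs y hy
    rw [norm_mul, norm_mul]
    exact mul_le_mul_of_nonneg_right ((hle y hy s hs).trans (le_abs_self _)) (norm_nonneg _)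
  · filter_upwards [ae_restrict_mem measurableSet_Ioi] with s hs y hy
    exact (hd y hy s hs).mul_const _

section Solution

variable {β : ℝ} {I : Set ℝ} {σ μ : ℝ → ℝ} {u : ℝ → ℝ → ℝ}

theorem IsFracDiffusionSolution.isLaplacePrimitive (hu : IsFracDiffusionSolution β I σ μ u)
    (hL : IsLaplaceDominated I u) {x : ℝ} (hx : x ∈ I) : IsLaplacePrimitive (u x) :=
  ⟨hu.continuousOn_time x hx, hu.differentiableAt_time x hx, hu.integrable_deriv x hx,
    hL.time x hx⟩

/-- Space derivatives pass under the integral sign of the Wright type transformation. -/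
theorem IsFracDiffusionSolution.hasDerivAt_space (hu : IsFracDiffusionSolution β I σ μ u)
    (hL : IsLaplaceDominated I u) (hI : IsOpen I) {α : ℝ} (h0 : 0 < α) (h1 : α < 1) {x t : ℝ}
    (hx : x ∈ I) (ht : 0 < t) :
    (LaplaceIntegrable (partialX u x) ∧ LaplaceIntegrable (partialXX u x)) ∧
    HasDerivAt (fun y => wrightTransform α (u y) t)
      (∫ s in Ioi (0 : ℝ), partialX u x s * wrightG α s t) x ∧
    HasDerivAt (fun y => ∫ s in Ioi (0 : ℝ), partialX u y s * wrightG α s t)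
      (∫ s in Ioi (0 : ℝ), partialXX u x s * wrightG α s t) x := by
  obtain ⟨N, hN, a, h, hh, hle⟩ := hL.space x hx
  have hh' : LaplaceIntegrable h := ⟨a, hh⟩
  have hM : IsOpen (interior N ∩ I) := isOpen_interior.inter hI
  have hxM : x ∈ interior N ∩ I := ⟨mem_interior_iff_mem_nhds.2 hN, hx⟩
  -- The domination concerns only `u_x` and `u_xx`; integrability of `u` itself comes from that of
  -- `u_t`.
  have hw : ∀ y ∈ interior N ∩ I, LaplaceIntegrable (u y) := fun y hy =>
    (hu.isLaplacePrimitive hL hy.2).laplaceIntegrable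
  have hd : ∀ y ∈ interior N ∩ I, ∀ s > 0, HasDerivAt (fun y => u y s) (partialX u y s) y :=
    fun y hy s hs => (hu.differentiableAt_space y hy.2 s hs).hasDerivAt
  have hd2 : ∀ y ∈ interior N ∩ I, ∀ s > 0,
      HasDerivAt (fun y => partialX u y s) (partialXX u y s) y :=
    fun y hy s hs => (hu.differentiableAt_space_two y hy.2 s hs).hasDerivAt
  have hb1 : ∀ y ∈ interior N ∩ I, ∀ s > 0, |partialX u y s| ≤ h s :=
    fun y hy s hs => (hle y (interior_subset hy.1) s hs).1
  have hb2 : ∀ y ∈ interior N ∩ I, ∀ s > 0, |partialXX u y s| ≤ h s :=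
    fun y hy s hs => (hle y (interior_subset hy.1) s hs).2
  have hw' : ∀ y ∈ interior N ∩ I, LaplaceIntegrable (partialX u y) := fun y hy =>
    .of_hasDerivAt hM hh' hw hd hb1 hy
  refine ⟨⟨hw' x hxM, .of_hasDerivAt hM hh' hw' hd2 hb2 hxM⟩, ?_,
    hasDerivAt_integral_mul_wrightG_param h0 h1 ht hM hh' hw' hd2 hb2 hxM⟩
  simp_rw [wrightTransform_of_pos α _ ht]
  exact hasDerivAt_integral_mul_wrightG_param h0 h1 ht hM hh' hw hd hb1 hxM

end Solution

/-! ### The transform solves the equation of order `βα`. -/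

theorem theorem4p2 (α β : ℝ) (hα0 : 0 < α) (hα1 : α < 1) (hβ0 : 0 < β) (hβ1 : β ≤ 1)
    (I : Set ℝ) (hI : IsOpen I) (σ μ : ℝ → ℝ) (u : ℝ → ℝ → ℝ)
    (hu : IsFracDiffusionSolution β I σ μ u) (hL : IsLaplaceDominated I u) :
    (∀ x ∈ I, ∀ t > 0, IntegrableOn (fun s => u x s * wrightG α s t) (Ioi 0)) ∧
      IsFracDiffusionSolution (β * α) I σ μ (fun x t => wrightTransform α (u x) t) := by
  have hf : ∀ {x}, x ∈ I → IsLaplacePrimitive (u x) := fun hx => hu.isLaplacePrimitive hL hx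
  have hc0 : 0 < β * α := mul_pos hβ0 hα0
  have hc1 : β * α < 1 := by nlinarith
  have hX : ∀ {x t}, x ∈ I → 0 < t → partialX (fun x t => wrightTransform α (u x) t) x t =
      ∫ s in Ioi (0 : ℝ), partialX u x s * wrightG α s t := fun hx ht =>
    (hu.hasDerivAt_space hL hI hα0 hα1 hx ht).2.1.deriv
  have hXX : ∀ {x t}, x ∈ I → 0 < t →
      HasDerivAt (fun y => partialX (fun x t => wrightTransform α (u x) t) y t)
        (∫ s in Ioi (0 : ℝ), partialXX u x s * wrightG α s t) x := fun {x t} hx ht => by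
    refine (hu.hasDerivAt_space hL hI hα0 hα1 hx ht).2.2.congr_of_eventuallyEq ?_
    -- The formula for the first derivative holds only on `I`; openness makes it hold near `x`, so
    -- it may be differentiated again.
    filter_upwards [hI.mem_nhds hx] with y hy using hX hy ht
  have hint : ∀ {x}, x ∈ I → ∀ {c : ℝ}, 0 ≤ c → c < 1 → ∀ {t}, 0 < t →
      IntervalIntegrable (fun τ => (t - τ) ^ (-c) * deriv (wrightTransform α (u x)) τ)
        volume 0 t := by
    intro x hx c hc hc' t ht
    rw [intervalIntegrable_iff_integrableOn_Ioc_of_le ht.le]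
    refine ((hf hx).laplace.integrableOn_sub_rpow_mul hα0 hα1 hc hc' ht).congr_fun
      (fun τ hτ => ?_) measurableSet_Ioc
    simp only
    rw [((hf hx).hasDerivAt_wrightTransform hα0 hα1 hτ.1).deriv]
  refine ⟨fun x hx t ht => (hf hx).laplaceIntegrable.integrableOn_mul_wrightG hα0 hα1 ht, ?_⟩
  refine ⟨fun x hx => (hf hx).continuousOn_wrightTransform hα0 hα1,
    fun x hx t ht => ((hf hx).hasDerivAt_wrightTransform hα0 hα1 ht).differentiableAt,
    fun x hx t ht => ?_, fun _ x hx t ht => hint hx hc0.le hc1 ht,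
    fun x hx t ht => (hu.hasDerivAt_space hL hI hα0 hα1 hx ht).2.1.differentiableAt,
    fun x hx t ht => (hXX hx ht).differentiableAt, fun x hx t ht => ?_⟩
  · simpa using hint hx le_rfl one_pos ht
  · obtain ⟨hl, hl'⟩ := (hu.hasDerivAt_space hL hI hα0 hα1 hx ht).1
    rw [partialXX, (hXX hx ht).deriv, hX hx ht, ← integral_const_mul, ← integral_const_mul,
      ← integral_add ((hl'.integrableOn_mul_wrightG hα0 hα1 ht).const_mul _)
        ((hl.integrableOn_mul_wrightG hα0 hα1 ht).const_mul _)]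
    -- Both sides are now integrals against `g_α(s;t)`, and the integrands agree by the equation of
    -- order `β` at time `s`.
    refine ((hf hx).caputoDeriv_wrightTransform hα0 hα1 hβ0 hβ1 ht).trans ?_
    refine setIntegral_congr_fun measurableSet_Ioi fun s hs => ?_
    rw [hu.equation x hx s hs]
    ring
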